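/- Let $\langle x,y\rangle=\sum_j x_jy_j$ and $\|x\|=\langle x,x\rangle^{1/2}$ on $\mathbb{R}^N$, let $z^2=\sum_j z_j^2$ for $z\in\mathbb{C}^N$, and let $\sigma_\alpha(x)=x-\frac{2\langle\alpha,x\rangle}{\|\alpha\|^2}\alpha$ for $0\neq\alpha\in\mathbb{R}^N$. Let $\mathcal{R}\subset\mathbb{R}^N\setminus\{0\}$ be a root system: a finite set, normalized by $\|\alpha\|^2=2$ for all $\alpha\in\mathcal{R}$, such that $-\mathcal{R}=\mathcal{R}$, such that $\alpha,r\alpha\in\mathcal{R}$ with $r\in\mathbb{R}$ implies $r=\pm1$, and such that $\sigma_\alpha(\mathcal{R})=\mathcal{R}$ for all $\alpha\in\mathcal{R}$. Let $G$ be the group generated by the reflections $\sigma_\alpha$, $\alpha\in\mathcal{R}$, and let $\mu:\mathcal{R}\to[0,\infty)$ be $G$-invariant. For $f\in C^1(\mathbb{R}^N)$ and $\xi\in\mathbb{R}^N$ the Dunkl operator is $$T_{\xi,\mu}f(x)=\partial_\xi f(x)+\frac12\sum_{\alpha\in\mathcal{R}}\mu(\alpha)\,\langle\alpha,\xi\rangle\,\frac{f(x)-f(\sigma_\alpha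 x)}{\langle\alpha,x\rangle},$$ where the quotient is replaced by its limit $\frac{2}{\|\alpha\|^2}\partial_\alpha f(x)$ when $\langle\alpha,x\rangle=0$. The Dunkl kernel $E_\mu:\mathbb{C}^N\times\mathbb{C}^N\to\mathbb{C}$ is the holomorphic function that is real valued on $\mathbb{R}^N\times\mathbb{R}^N$ and satisfies there, for all $x,y,\xi\in\mathbb{R}^N$, $$T^x_{\xi,\mu}E_\mu(x,y)=\langle\xi,y\rangle E_\mu(x,y),\qquad E_\mu(0,y)=1.$$ For $t>0$ the Dunkl heat kernel is $$\rho_{\mu,t}(x,q)=e^{-(\|x\|^2+\|q\|^2)/2t}\,E_\mu\!\left(\frac{x}{t^{1/2}},\frac{q}{t^{1/2}}\right)\qquad(x,q\in\mathbb{R}^N),$$ and $\rho_{\mu,t}$ also denotes its holomorphic continuation to $\mathbb{C}^N\times\mathbb{C}^N$. The kernel of the Version A Segal–Bargmann transform is $$A_{\mu,t}(z,q)=\exp\!\left(-\frac{z^2}{2t}-\frac{\|q\|^2}{4t}\right)E_\mu\!\left(\frac{z}{t^{1/2}},\frac{q}{t^{1/2}}\right)\qquad(z\in\mathbb{C}^N,\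 q\in\mathbb{R}^N).$$ **Theorem (Version A).** Suppose that $\mu\ge0$ and $t>0$. Then the Dunkl kernel $E_\mu$ and the holomorphic continuation of $\rho_{\mu,t}$ exist, $\rho_{\mu,t}(0,q)>0$ for all $q\in\mathbb{R}^N$, and $$A_{\mu,t}(z,q)=\frac{\rho_{\mu,t}(z,q)}{\left(\rho_{\mu,t}(0,q)\right)^{1/2}}$$ for all $z\in\mathbb{C}^N$ and $q\in\mathbb{R}^N$, with the positive square root in the denominator. -/

import Mathlib

noncomputable section

namespace Dunkl

/-- The configuration space `ℝ^N` with its Euclidean inner product. -/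
abbrev RealSpace (N : ℕ) : Type := EuclideanSpace ℝ (Fin N)

/-- The phase space `ℂ^N`. -/
abbrev ComplexSpace (N : ℕ) : Type := EuclideanSpace ℂ (Fin N)

/-- The inclusion of `ℝ^N` in `ℂ^N`. -/
def toComplex {N : ℕ} (x : RealSpace N) : ComplexSpace N :=
  WithLp.toLp 2 (fun j => (x j : ℂ))

/-- The holomorphic (not Hermitian) square `z ^ 2 = ∑ j, z_j ^ 2` on `ℂ^N`. -/
def bilinSq {N : ℕ} (z : ComplexSpace N) : ℂ := ∑ j, z j ^ 2

/-- The orthogonal reflection `σ_α` in the hyperplane orthogonal to `α`. -/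
def rootReflection {N : ℕ} (α : RealSpace N) : RealSpace N ≃ₗᵢ[ℝ] RealSpace N :=
  (Submodule.span ℝ {α})ᗮ.reflection

theorem rootReflection_apply {N : ℕ} (α x : RealSpace N) :
    rootReflection α x = x - (2 * inner ℝ α x / ‖α‖ ^ 2) • α := by
  rw [rootReflection, Submodule.reflection_orthogonal_apply, Submodule.reflection_singleton_apply]
  simp only [RCLike.ofReal_real_eq_id, id_eq, neg_sub, mul_div_assoc, mul_smul]
  rw [two_smul, two_smul]

/-- A (reduced) root system in `ℝ^N`, normalized so that every root has squared norm `2`. -/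
structure IsRootSystem {N : ℕ} (R : Finset (RealSpace N)) : Prop where
  ne_zero : ∀ α ∈ R, α ≠ 0
  neg_mem : ∀ α ∈ R, -α ∈ R
  reduced : ∀ α ∈ R, ∀ r : ℝ, r • α ∈ R → r = 1 ∨ r = -1
  reflection_image : ∀ α ∈ R, rootReflection α '' (R : Set (RealSpace N)) = R
  norm_sq : ∀ α ∈ R, ‖α‖ ^ 2 = 2

/-- The finite Coxeter group `G(R)`: the group of isometries generated by the reflections. -/
def coxeterGroup {N : ℕ} (R : Finset (RealSpace N)) :
    Subgroup (RealSpace N ≃ₗᵢ[ℝ] RealSpace N) :=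
  Subgroup.closure {g | ∃ α ∈ R, g = rootReflection α}

/-- A multiplicity function is a function on the roots that is invariant under `G(R)`. -/
def IsMultiplicityFunction {N : ℕ} (R : Finset (RealSpace N)) (μ : R → ℝ) : Prop :=
  ∀ g ∈ coxeterGroup R, ∀ α β : R, (β : RealSpace N) = g α → μ β = μ α

/-- The difference quotient `(f x - f (σ_α x)) / ⟨α, x⟩`. On the hyperplane `⟨α, x⟩ = 0` it stands
for its limit, which for a `C^1` function `f` is `(2 / ‖α‖ ^ 2) ∂_α f x`. -/
def reflectionQuotient {N : ℕ} (α : RealSpace N) (f : RealSpace N → ℂ) (x : RealSpace N) : ℂ :=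
  if inner ℝ α x = 0 then ((2 / ‖α‖ ^ 2 : ℝ) : ℂ) * fderiv ℝ f x α
  else (f x - f (rootReflection α x)) / ((inner ℝ α x : ℝ) : ℂ)

/-- The Dunkl operator `T_{ξ,μ}`, written as half of a sum over all roots, which equals the sum over
the positive roots for any choice of these. -/
def dunklOperator {N : ℕ} {R : Finset (RealSpace N)} (μ : R → ℝ) (ξ : RealSpace N)
    (f : RealSpace N → ℂ) (x : RealSpace N) : ℂ :=
  fderiv ℝ f x ξ +
    (1 / 2) * ∑ α : R, ((μ α * inner ℝ (α : RealSpace N) ξ : ℝ) : ℂ) *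
      reflectionQuotient (α : RealSpace N) f x

/-- Joint holomorphy of a function on `ℂ^N × ℂ^N`. -/
def IsHolomorphic {N : ℕ} (F : ComplexSpace N → ComplexSpace N → ℂ) : Prop :=
  Differentiable ℂ (fun p : ComplexSpace N × ComplexSpace N => F p.1 p.2)

/-- `E` is the holomorphic extension to `ℂ^N × ℂ^N` of a real valued solution on `ℝ^N × ℝ^N` of
`T_ξ E(·, y) = ⟨ξ, y⟩ E(·, y)`, `E(0, y) = 1`. -/
structure IsDunklKernel {N : ℕ} {R : Finset (RealSpace N)} (μ : R → ℝ)
    (E : ComplexSpace N → ComplexSpace N → ℂ) : Prop where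
  holomorphic : IsHolomorphic E
  real_valued : ∀ x y : RealSpace N, (E (toComplex x) (toComplex y)).im = 0
  eigen : ∀ ξ x y : RealSpace N,
    dunklOperator μ ξ (fun u => E (toComplex u) (toComplex y)) x =
      ((inner ℝ ξ y : ℝ) : ℂ) * E (toComplex x) (toComplex y)
  map_zero : ∀ y : RealSpace N, E 0 (toComplex y) = 1

/-- The Dunkl kernel `E_μ` on `ℂ^N × ℂ^N`. -/
def dunklKernel {N : ℕ} {R : Finset (RealSpace N)} (μ : R → ℝ) :
    ComplexSpace N → ComplexSpace N → ℂ :=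
  Classical.epsilon (IsDunklKernel μ)

/-- The Dunkl heat kernel
`ρ_{μ,t}(x, q) = exp (-(x^2 + q^2) / 2t) E_μ(x / t^{1/2}, q / t^{1/2})` on `ℝ^N × ℝ^N`.
The kernel `E_μ` is real on real arguments, so that `re` only changes the type. -/
def heatKernel {N : ℕ} {R : Finset (RealSpace N)} (μ : R → ℝ) (t : ℝ) (x q : RealSpace N) : ℝ :=
  Real.exp (-(‖x‖ ^ 2 + ‖q‖ ^ 2) / (2 * t)) *
    (dunklKernel μ (toComplex ((Real.sqrt t)⁻¹ • x)) (toComplex ((Real.sqrt t)⁻¹ • q))).re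

/-- `F` is a holomorphic continuation to `ℂ^N × ℂ^N` of the function `f` on `ℝ^N × ℝ^N`. -/
structure IsHolomorphicContinuation {N : ℕ} (f : RealSpace N → RealSpace N → ℝ)
    (F : ComplexSpace N → ComplexSpace N → ℂ) : Prop where
  holomorphic : IsHolomorphic F
  extends_real : ∀ x y : RealSpace N, F (toComplex x) (toComplex y) = (f x y : ℂ)

/-- The holomorphic continuation of the Dunkl heat kernel to `ℂ^N × ℂ^N`. -/
def heatKernelC {N : ℕ} {R : Finset (RealSpace N)} (μ : R → ℝ) (t : ℝ) :
    ComplexSpace N → ComplexSpace N → ℂ :=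
  Classical.epsilon (IsHolomorphicContinuation (heatKernel μ t))

/-- The kernel `A_{μ,t}(z, q) = exp (-z^2 / 2t - q^2 / 4t) E_μ(z / t^{1/2}, q / t^{1/2})` of the
Version A Segal–Bargmann transform. -/
def versionAKernel {N : ℕ} {R : Finset (RealSpace N)} (μ : R → ℝ) (t : ℝ)
    (z : ComplexSpace N) (q : RealSpace N) : ℂ :=
  Complex.exp (-bilinSq z / (2 * (t : ℂ)) - ((‖q‖ ^ 2 : ℝ) : ℂ) / (4 * (t : ℂ))) *
    dunklKernel μ ((((Real.sqrt t)⁻¹ : ℝ) : ℂ) • z) (toComplex ((Real.sqrt t)⁻¹ • q))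

end Dunkl

end

/-!
The coefficient of `f (w x)`, `w = σ_β σ_γ`, in the commutator of two Dunkl operators is a ratio of
minors of the roots `β` and `γ`. For fixed `w` it is a difference of the values at `β` and `γ` of
one function on the roots, so that these coefficients cancel in the sum and the Dunkl operators
commute.

The kernel is a series of homogeneous components `E_n`. The radial operator `∑ j, x_j T_j` acts on
functions of degree `n` as `n + L`, where `L` generates a random walk on the finite reflection
group; here `μ ≥ 0` enters, since by the maximum principle `n + L` is then invertible for `n > 0`,
with nonnegative inverse of total mass `1 / n`. Averaging `⟨x, y⟩ E_n` with the weights of degree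
`n + 1` therefore solves the radial equation for `E_{n + 1}` and keeps the bound
`|E_n(z, w)| ≤ (‖z‖ ‖w‖) ^ n / n!`. The radial equation already implies the others: by commutativity
the error is a closed one-form for the Dunkl operators that is annihilated by the radial direction,
and the maximum principle forces it to vanish.

Since `E(0, ·) = 1`, the value `ρ_t(0, q) = exp (-‖q‖ ^ 2 / 2t)` is explicit, and the identity for
the Version A kernel is a comparison of Gaussian factors, once the continuation of `ρ_t` is known to
be unique.
-/

noncomputable section

namespace Dunkl

open Filter Topology
open scoped InnerProductSpace

/-! ### Roots and reflections -/

section Roots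

variable {N : ℕ} {R : Finset (RealSpace N)}

theorem IsRootSystem.reflection_apply (hR : IsRootSystem R) (β : R) (x : RealSpace N) :
    rootReflection β.1 x = x - ⟪β.1, x⟫_ℝ • β.1 := by
  rw [rootReflection_apply, hR.norm_sq β β.2, mul_div_cancel_left₀ _ two_ne_zero]

@[simp]
theorem rootReflection_rootReflection (α x : RealSpace N) :
    rootReflection α (rootReflection α x) = x :=
  Submodule.reflection_reflection _ _

theorem inner_rootReflection (α x y : RealSpace N) :
    ⟪rootReflection α x, y⟫_ℝ = ⟪x, rootReflection α y⟫_ℝ := by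
  rw [← LinearIsometryEquiv.inner_map_map (rootReflection α) x, rootReflection_rootReflection]

theorem IsRootSystem.reflection_mem (hR : IsRootSystem R) {α β : RealSpace N} (hβ : β ∈ R)
    (hα : α ∈ R) : rootReflection β α ∈ R := by
  rw [← Finset.mem_coe, ← hR.reflection_image β hβ]
  exact Set.mem_image_of_mem _ hα

/-- The permutation of the roots induced by the reflection `σ_β`. -/
def IsRootSystem.rootPerm (hR : IsRootSystem R) (β : R) : Equiv.Perm R :=
  Function.Involutive.toPerm (fun α => ⟨rootReflection β.1 α, hR.reflection_mem β.2 α.2⟩)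
    fun _ => Subtype.ext (rootReflection_rootReflection _ _)

@[simp]
theorem IsRootSystem.coe_rootPerm (hR : IsRootSystem R) (β α : R) :
    (hR.rootPerm β α : RealSpace N) = rootReflection β.1 α := rfl

theorem IsRootSystem.rootReflection_rootPerm (hR : IsRootSystem R) (β γ : R) (x : RealSpace N) :
    rootReflection (hR.rootPerm β γ : RealSpace N) x =
      rootReflection β.1 (rootReflection γ.1 (rootReflection β.1 x)) := by
  rw [hR.reflection_apply, hR.reflection_apply γ, map_sub, map_smul,
    rootReflection_rootReflection, hR.coe_rootPerm, inner_rootReflection]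

theorem IsMultiplicityFunction.rootPerm {μ : R → ℝ} (hμ : IsMultiplicityFunction R μ)
    (hR : IsRootSystem R) (β α : R) : μ (hR.rootPerm β α) = μ α :=
  hμ (rootReflection β.1) (Subgroup.subset_closure ⟨β, β.2, rfl⟩) _ _ rfl

/-- A point of `ℝ^N` is regular if it lies on none of the reflecting hyperplanes. -/
def IsRegular (R : Finset (RealSpace N)) (x : RealSpace N) : Prop :=
  ∀ α ∈ R, ⟪α, x⟫_ℝ ≠ 0

theorem IsRegular.reflection (hR : IsRootSystem R) {x : RealSpace N} (hx : IsRegular R x)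
    {β : RealSpace N} (hβ : β ∈ R) : IsRegular R (rootReflection β x) := by
  intro α hα
  rw [← inner_rootReflection]
  exact hx _ (hR.reflection_mem hβ hα)

theorem isOpen_setOf_isRegular (R : Finset (RealSpace N)) : IsOpen {x | IsRegular R x} := by
  simp only [IsRegular, Set.ofPred_forall]
  exact isOpen_biInter_finset fun α _ =>
    isOpen_ne_fun (continuous_const.inner continuous_id) continuous_const

theorem IsRegular.eventually {x : RealSpace N} (hx : IsRegular R x) : ∀ᶠ z in 𝓝 x, IsRegular R z :=
  (isOpen_setOf_isRegular R).mem_nhds hx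

theorem dense_setOf_inner_ne_zero {α : RealSpace N} (hα : α ≠ 0) :
    Dense {x : RealSpace N | ⟪α, x⟫_ℝ ≠ 0} := by
  rw [show {x : RealSpace N | ⟪α, x⟫_ℝ ≠ 0} = ((ℝ ∙ α)ᗮ : Set (RealSpace N))ᶜ by
    ext x; simp [Submodule.mem_orthogonal_singleton_iff_inner_right],
    ← interior_eq_empty_iff_dense_compl, ← Set.not_nonempty_iff_eq_empty]
  intro h
  have hmem : α ∈ (ℝ ∙ α)ᗮ := Submodule.eq_top_of_nonempty_interior' _ h ▸ Submodule.mem_top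
  rw [Submodule.mem_orthogonal_singleton_iff_inner_right] at hmem
  exact hα (inner_self_eq_zero.1 hmem)

theorem IsRootSystem.dense_setOf_isRegular (hR : IsRootSystem R) : Dense {x | IsRegular R x} := by
  simp only [IsRegular, Set.ofPred_forall]
  exact dense_biInter_of_isOpen
    (fun α _ => isOpen_ne_fun (continuous_const.inner continuous_id) continuous_const)
    R.countable_toSet fun α hα => dense_setOf_inner_ne_zero (hR.ne_zero α hα)

end Roots

/-! ### Products of two reflections -/

section MinorRatio

variable {N : ℕ}

/-- The `2 × 2` minor of the pairings of `β`, `γ` with `ξ`, `η`, divided by `⟨β, x⟩ ⟨γ, x⟩`. In the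
commutator of two Dunkl operators it is the coefficient belonging to the roots `β`, `γ`. -/
def minorRatio (ξ η x β γ : RealSpace N) : ℝ :=
  (⟪β, ξ⟫_ℝ * ⟪γ, η⟫_ℝ - ⟪β, η⟫_ℝ * ⟪γ, ξ⟫_ℝ) / (⟪β, x⟫_ℝ * ⟪γ, x⟫_ℝ)

theorem minorRatio_swap (ξ η x β γ : RealSpace N) :
    minorRatio ξ η x γ β = -minorRatio ξ η x β γ := by
  rw [minorRatio, minorRatio, mul_comm ⟪γ, x⟫_ℝ]
  ring

@[simp]
theorem minorRatio_zero_right (ξ η x β : RealSpace N) : minorRatio ξ η x β 0 = 0 := by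
  simp [minorRatio]

theorem minorRatio_smul_self_right (ξ η x β : RealSpace N) (c : ℝ) :
    minorRatio ξ η x β (c • β) = 0 := by
  rw [minorRatio, div_eq_zero_iff]
  left
  simp only [real_inner_smul_left]
  ring

theorem minorRatio_sub_minorRatio {x β γ : RealSpace N} (hβ : ⟪β, x⟫_ℝ ≠ 0) (hγ : ⟪γ, x⟫_ℝ ≠ 0)
    {p q : ℝ} (hv : ⟪p • β + q • γ, x⟫_ℝ ≠ 0) (ξ η : RealSpace N) :
    minorRatio ξ η x β (p • β + q • γ) - minorRatio ξ η x γ (p • β + q • γ) =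
      minorRatio ξ η x β γ := by
  simp only [minorRatio, inner_add_left, real_inner_smul_left] at hv ⊢
  field_simp
  ring

theorem sub_map_eq_zero_of_inner_eq_zero (w : RealSpace N ≃ₗᵢ[ℝ] RealSpace N) {x : RealSpace N}
    (h : ⟪x - w x, x⟫_ℝ = 0) : x - w x = 0 := by
  rw [inner_sub_left, real_inner_self_eq_norm_sq, sub_eq_zero] at h
  rw [← norm_eq_zero, ← sq_eq_zero_iff, norm_sub_sq_real, real_inner_comm, ← h, w.norm_map]
  ring

variable {R : Finset (RealSpace N)} (hR : IsRootSystem R)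

include hR

theorem IsRootSystem.sub_reflection_mul_reflection_apply (β γ : R) (x : RealSpace N) :
    x - (rootReflection β.1 * rootReflection γ.1) x =
      (⟪β.1, x⟫_ℝ - ⟪γ.1, x⟫_ℝ * ⟪β.1, γ.1⟫_ℝ) • β.1 + ⟪γ.1, x⟫_ℝ • γ.1 := by
  simp only [LinearIsometryEquiv.coe_mul, Function.comp_apply, hR.reflection_apply,
    inner_sub_right, inner_smul_right]
  module

theorem IsRootSystem.minorRatio_eq_sub {x : RealSpace N} (hx : IsRegular R x) (ξ η : RealSpace N)
    (β γ : R) :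
    minorRatio ξ η x β γ =
      minorRatio ξ η x β (x - (rootReflection β.1 * rootReflection γ.1) x) -
        minorRatio ξ η x γ (x - (rootReflection β.1 * rootReflection γ.1) x) := by
  have hγ := hx γ γ.2
  have hv := hR.sub_reflection_mul_reflection_apply β γ x
  by_cases h : ⟪x - (rootReflection β.1 * rootReflection γ.1) x, x⟫_ℝ = 0
  · rw [sub_map_eq_zero_of_inner_eq_zero _ h] at hv ⊢
    have hγβ : γ.1 = (-(⟪β.1, x⟫_ℝ - ⟪γ.1, x⟫_ℝ * ⟪β.1, γ.1⟫_ℝ) / ⟪γ.1, x⟫_ℝ) • β.1 := by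
      rw [div_eq_inv_mul, mul_smul, neg_smul, ← eq_neg_of_add_eq_zero_right hv.symm,
        inv_smul_smul₀ hγ]
    rw [hγβ, minorRatio_smul_self_right]
    simp only [minorRatio_zero_right, sub_zero]
  · rw [hv] at h ⊢
    exact (minorRatio_sub_minorRatio (hx β β.2) hγ h ξ η).symm

variable {μ : R → ℝ} (hμ : IsMultiplicityFunction R μ)

include hμ

theorem IsRootSystem.sum_reflection_mul_reflection_comm {F : Type*} [AddCommGroup F] [Module ℝ F]
    (Φ : (RealSpace N ≃ₗᵢ[ℝ] RealSpace N) → R → F) :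
    ∑ β : R, ∑ γ : R, (μ β * μ γ) • Φ (rootReflection β.1 * rootReflection γ.1) β =
      ∑ β : R, ∑ γ : R, (μ β * μ γ) • Φ (rootReflection β.1 * rootReflection γ.1) γ := by
  conv_rhs => rw [Finset.sum_comm]
  refine Finset.sum_congr rfl fun γ _ => ?_
  rw [← Equiv.sum_comp (hR.rootPerm γ)]
  refine Finset.sum_congr rfl fun β _ => ?_
  have hprod : rootReflection γ.1 * rootReflection (hR.rootPerm γ β).1 =
      rootReflection β.1 * rootReflection γ.1 := by
    ext1 v
    simp only [LinearIsometryEquiv.coe_mul, Function.comp_apply, hR.rootReflection_rootPerm,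
      rootReflection_rootReflection]
  rw [hprod, hμ.rootPerm hR, mul_comm (μ γ)]

theorem IsRootSystem.sum_minorRatio_smul_eq_zero {F : Type*} [AddCommGroup F] [Module ℝ F]
    {x : RealSpace N} (hx : IsRegular R x) (ξ η : RealSpace N) (f : RealSpace N → F) :
    ∑ β : R, ∑ γ : R, (μ β * μ γ * minorRatio ξ η x β γ) •
      f (rootReflection β.1 (rootReflection γ.1 x)) = 0 := by
  have hcancel := hR.sum_reflection_mul_reflection_comm hμ
    fun w β => minorRatio ξ η x β (x - w x) • f (w x)
  rw [← sub_eq_zero, ← Finset.sum_sub_distrib] at hcancel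
  simp only [← Finset.sum_sub_distrib, ← smul_sub, ← sub_smul, ← hR.minorRatio_eq_sub hx]
    at hcancel
  simpa only [smul_smul, LinearIsometryEquiv.coe_mul, Function.comp_apply] using hcancel

end MinorRatio

/-! ### The difference part of the Dunkl operators -/

section Difference

theorem sum_sum_smul_eq_zero_of_antisymm {ι F : Type*} [Fintype ι] [AddCommGroup F] [Module ℝ F]
    {m : ι → ι → ℝ} {s : ι → ι → F} (hm : ∀ i j, m j i = -m i j) (hs : ∀ i j, s j i = s i j) :
    ∑ i, ∑ j, m i j • s i j = 0 := by
  have hneg : ∑ i, ∑ j, m i j • s i j = -∑ i, ∑ j, m i j • s i j := by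
    conv_lhs => rw [Finset.sum_comm]
    simp only [← Finset.sum_neg_distrib]
    exact Finset.sum_congr rfl fun i _ => Finset.sum_congr rfl fun j _ => by
      rw [hm i j, hs i j, neg_smul]
  have : IsAddTorsionFree F := .of_isTorsionFree ℝ F
  exact self_eq_neg.1 hneg

variable {N : ℕ} {R : Finset (RealSpace N)} {F : Type*} [AddCommGroup F] [Module ℝ F]

/-- The coefficient of `f x - f (σ_α x)` in the Dunkl operator `T_ξ f (x)` at a regular point. -/
def dunklWeight (μ : R → ℝ) (ξ x : RealSpace N) (α : R) : ℝ :=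
  μ α / 2 * (⟪α.1, ξ⟫_ℝ / ⟪α.1, x⟫_ℝ)

/-- The difference part `f ↦ T_ξ f - ∂_ξ f` of the Dunkl operator at regular points; elsewhere
division by zero makes the singular terms vanish. -/
def dunklDifference (μ : R → ℝ) (ξ : RealSpace N) : (RealSpace N → F) →ₗ[ℝ] (RealSpace N → F) where
  toFun f x := ∑ α : R, dunklWeight μ ξ x α • (f x - f (rootReflection α.1 x))
  map_add' f g := by
    ext x
    simp only [Pi.add_apply, ← Finset.sum_add_distrib, ← smul_add]
    exact Finset.sum_congr rfl fun _ _ => by rw [add_sub_add_comm]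
  map_smul' c f := by
    ext x
    simp only [Pi.smul_apply, ← smul_sub, RingHom.id_apply, Finset.smul_sum, smul_comm c]

theorem dunklDifference_apply (μ : R → ℝ) (ξ : RealSpace N) (f : RealSpace N → F)
    (x : RealSpace N) :
    dunklDifference μ ξ f x = ∑ α : R, dunklWeight μ ξ x α • (f x - f (rootReflection α.1 x)) :=
  rfl

variable {μ : R → ℝ}

theorem dunklWeight_reflection_right (hR : IsRootSystem R) (ξ x : RealSpace N) (β γ : R) :
    dunklWeight μ (rootReflection β.1 ξ) x γ =
      dunklWeight μ ξ x γ - ⟪β.1, ξ⟫_ℝ * dunklWeight μ β.1 x γ := by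
  simp only [dunklWeight, hR.reflection_apply, inner_sub_right, inner_smul_right]
  ring

theorem dunklWeight_rootPerm (hR : IsRootSystem R) (hμ : IsMultiplicityFunction R μ)
    (ξ x : RealSpace N) (β γ : R) :
    dunklWeight μ ξ (rootReflection β.1 x) (hR.rootPerm β γ) =
      dunklWeight μ (rootReflection β.1 ξ) x γ := by
  simp only [dunklWeight, hμ.rootPerm hR, hR.coe_rootPerm, LinearIsometryEquiv.inner_map_map,
    inner_rootReflection]

theorem dunklWeight_mul_sub (ξ η x : RealSpace N) (β γ : R) :
    dunklWeight μ ξ x β * dunklWeight μ η x γ - dunklWeight μ η x β * dunklWeight μ ξ x γ =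
      4⁻¹ * (μ β * μ γ * minorRatio ξ η x β γ) := by
  simp only [dunklWeight, minorRatio]
  ring

theorem dunklWeight_mul_reflection_sub (hR : IsRootSystem R) (ξ η x : RealSpace N) (β γ : R) :
    dunklWeight μ ξ x β * dunklWeight μ (rootReflection β.1 η) x γ -
        dunklWeight μ η x β * dunklWeight μ (rootReflection β.1 ξ) x γ =
      4⁻¹ * (μ β * μ γ * minorRatio ξ η x β γ) := by
  rw [← dunklWeight_mul_sub, dunklWeight_reflection_right hR, dunklWeight_reflection_right hR]
  simp only [dunklWeight]
  ring

theorem dunklDifference_reflection (hR : IsRootSystem R) (hμ : IsMultiplicityFunction R μ)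
    (ξ x : RealSpace N) (f : RealSpace N → F) (β : R) :
    dunklDifference μ ξ f (rootReflection β.1 x) =
      ∑ γ : R, dunklWeight μ (rootReflection β.1 ξ) x γ •
        (f (rootReflection β.1 x) - f (rootReflection β.1 (rootReflection γ.1 x))) := by
  rw [dunklDifference_apply, ← Equiv.sum_comp (hR.rootPerm β)]
  simp only [dunklWeight_rootPerm hR hμ, hR.rootReflection_rootPerm, rootReflection_rootReflection]

theorem dunklDifference_dunklDifference_apply (hR : IsRootSystem R)
    (hμ : IsMultiplicityFunction R μ) (ξ η x : RealSpace N) (f : RealSpace N → F) :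
    dunklDifference μ η (dunklDifference μ ξ f) x =
      ∑ β : R, ∑ γ : R,
        ((dunklWeight μ η x β * dunklWeight μ ξ x γ) • (f x - f (rootReflection γ.1 x)) -
          (dunklWeight μ η x β * dunklWeight μ (rootReflection β.1 ξ) x γ) •
            (f (rootReflection β.1 x) - f (rootReflection β.1 (rootReflection γ.1 x)))) := by
  rw [dunklDifference_apply]
  refine Finset.sum_congr rfl fun β _ => ?_
  rw [dunklDifference_reflection hR hμ, dunklDifference_apply, ← Finset.sum_sub_distrib,
    Finset.smul_sum]
  simp only [smul_sub _ (_ • _), smul_smul]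

theorem dunklDifference_comm (hR : IsRootSystem R) (hμ : IsMultiplicityFunction R μ)
    {x : RealSpace N} (hx : IsRegular R x) (ξ η : RealSpace N) (f : RealSpace N → F) :
    dunklDifference μ η (dunklDifference μ ξ f) x =
      dunklDifference μ ξ (dunklDifference μ η f) x := by
  set m : R → R → ℝ := fun β γ => μ β * μ γ * minorRatio ξ η x β γ
  set s : R → R → F := fun β γ =>
    f x - f (rootReflection γ.1 x) - f (rootReflection β.1 x) with hs
  have hanti : ∑ β : R, ∑ γ : R, m β γ • s β γ = 0 :=
    sum_sum_smul_eq_zero_of_antisymm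
      (fun β γ => by simp only [m, minorRatio_swap ξ η x β.1]; ring)
      (fun β γ => by simp only [s]; abel)
  have hprod := hR.sum_minorRatio_smul_eq_zero hμ hx ξ η f
  rw [← sub_eq_zero, dunklDifference_dunklDifference_apply hR hμ,
    dunklDifference_dunklDifference_apply hR hμ, ← Finset.sum_sub_distrib]
  calc _ = -((4⁻¹ : ℝ) • (∑ β : R, ∑ γ : R, m β γ • s β γ +
        ∑ β : R, ∑ γ : R, m β γ • f (rootReflection β.1 (rootReflection γ.1 x)))) := by
        simp only [← Finset.sum_sub_distrib, ← Finset.sum_add_distrib, Finset.smul_sum,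
          ← Finset.sum_neg_distrib]
        refine Finset.sum_congr rfl fun β _ => Finset.sum_congr rfl fun γ _ => ?_
        have h₁ := dunklWeight_mul_sub (μ := μ) ξ η x β γ
        have h₂ := dunklWeight_mul_reflection_sub (μ := μ) hR ξ η x β γ
        rw [← smul_add, smul_smul, hs]
        linear_combination (norm := module) -(h₁ • (f x - f (rootReflection γ.1 x))) + h₂ •
          (f (rootReflection β.1 x) - f (rootReflection β.1 (rootReflection γ.1 x)))
    _ = 0 := by rw [hanti, hprod, add_zero, smul_zero, neg_zero]

end Difference

section DifferenceCalculus

variable {N : ℕ} {R : Finset (RealSpace N)} {μ : R → ℝ} {F : Type*} [NormedAddCommGroup F]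
  [NormedSpace ℝ F] {f : RealSpace N → F} {x : RealSpace N}

theorem hasFDerivAt_dunklWeight (hx : IsRegular R x) (ξ : RealSpace N) (α : R) :
    HasFDerivAt (fun z => dunklWeight μ ξ z α)
      ((-dunklWeight μ ξ x α / ⟪α.1, x⟫_ℝ) • innerSL ℝ α.1) x := by
  have hα := hx α α.2
  have hinv : HasFDerivAt (fun z => (⟪α.1, z⟫_ℝ)⁻¹) (-(⟪α.1, x⟫_ℝ ^ 2)⁻¹ • innerSL ℝ α.1) x :=
    (hasDerivAt_inv hα).comp_hasFDerivAt x (innerSL ℝ α.1).hasFDerivAt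
  refine (hinv.const_mul (μ α / 2 * ⟪α.1, ξ⟫_ℝ)).congr_fderiv ?_ |>.congr_of_eventuallyEq
    (.of_forall fun z => by simp only [dunklWeight]; ring)
  rw [smul_smul, dunklWeight]
  congr 1
  field_simp

theorem hasFDerivAt_dunklDifference (hx : IsRegular R x) (hf : Differentiable ℝ f)
    (ξ : RealSpace N) :
    HasFDerivAt (dunklDifference μ ξ f)
      (∑ α : R, (dunklWeight μ ξ x α • (fderiv ℝ f x - (fderiv ℝ f (rootReflection α.1 x)).comp
          (rootReflection α.1 : RealSpace N →L[ℝ] RealSpace N)) +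
        ((-dunklWeight μ ξ x α / ⟪α.1, x⟫_ℝ) • innerSL ℝ α.1).smulRight
          (f x - f (rootReflection α.1 x)))) x :=
  HasFDerivAt.fun_sum fun α _ => (hasFDerivAt_dunklWeight hx ξ α).smul <|
    (hf x).hasFDerivAt.sub <| (hf _).hasFDerivAt.comp x
      (rootReflection α.1 : RealSpace N →L[ℝ] RealSpace N).hasFDerivAt

theorem fderiv_dunklDifference_add_comm (hR : IsRootSystem R) (hx : IsRegular R x)
    (hf : Differentiable ℝ f) (ξ η : RealSpace N) :
    fderiv ℝ (dunklDifference μ ξ f) x η + dunklDifference μ η (fun z => fderiv ℝ f z ξ) x =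
      fderiv ℝ (dunklDifference μ η f) x ξ + dunklDifference μ ξ (fun z => fderiv ℝ f z η) x := by
  rw [(hasFDerivAt_dunklDifference hx hf ξ).fderiv, (hasFDerivAt_dunklDifference hx hf η).fderiv]
  simp only [sum_apply, dunklDifference_apply, ← Finset.sum_add_distrib]
  refine Finset.sum_congr rfl fun α _ => ?_
  have hσ (v : RealSpace N) : (rootReflection α.1 : RealSpace N →L[ℝ] RealSpace N) v =
      v - ⟪α.1, v⟫_ℝ • α.1 := hR.reflection_apply α v
  simp only [add_apply, smul_apply, sub_apply, ContinuousLinearMap.comp_apply, hσ, map_sub,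
    map_smul, ContinuousLinearMap.smulRight_apply, innerSL_apply_apply, smul_eq_mul, dunklWeight]
  module

end DifferenceCalculus

/-! ### Dunkl operators -/

section Operators

variable {N : ℕ} {R : Finset (RealSpace N)}

/-- The real-linear map `ξ ↦ T_ξ f (x)`, the Dunkl analogue of the differential of `f` at `x`. -/
def dunklDifferential (μ : R → ℝ) (f : RealSpace N → ℂ) (x : RealSpace N) : RealSpace N →L[ℝ] ℂ :=
  fderiv ℝ f x + ∑ α : R, (μ α / 2) • (innerSL ℝ α.1).smulRight (reflectionQuotient α.1 f x)

variable {μ : R → ℝ} {f : RealSpace N → ℂ} {x : RealSpace N}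

theorem dunklDifferential_apply (ξ : RealSpace N) :
    dunklDifferential μ f x ξ =
      fderiv ℝ f x ξ + ∑ α : R, (μ α / 2 * ⟪α.1, ξ⟫_ℝ) • reflectionQuotient α.1 f x := by
  simp only [dunklDifferential, add_apply, sum_apply, smul_apply,
    ContinuousLinearMap.smulRight_apply, innerSL_apply_apply, smul_smul]

theorem dunklOperator_eq (ξ : RealSpace N) :
    dunklOperator μ ξ f x = dunklDifferential μ f x ξ := by
  rw [dunklOperator, dunklDifferential_apply, Finset.mul_sum]
  congr 1
  refine Finset.sum_congr rfl fun α _ => ?_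
  rw [Complex.real_smul]
  push_cast
  ring

theorem inner_smul_reflectionQuotient (α : RealSpace N) (f : RealSpace N → ℂ) (x : RealSpace N) :
    ⟪α, x⟫_ℝ • reflectionQuotient α f x = f x - f (rootReflection α x) := by
  rw [reflectionQuotient]
  split_ifs with h
  · rw [h, zero_smul, rootReflection_apply, h, mul_zero, zero_div, zero_smul, sub_zero, sub_self]
  · rw [Complex.real_smul, mul_div_cancel₀ _ (Complex.ofReal_ne_zero.2 h)]

theorem dunklDifferential_apply_self :
    dunklDifferential μ f x x =
      fderiv ℝ f x x + ∑ α : R, (μ α / 2) • (f x - f (rootReflection α.1 x)) := by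
  simp only [dunklDifferential_apply, ← inner_smul_reflectionQuotient, smul_smul]

theorem dunklDifferential_const (a : ℂ) (x : RealSpace N) :
    dunklDifferential μ (fun _ => a) x = 0 := by
  ext ξ
  simp [dunklDifferential_apply, reflectionQuotient]

theorem hasSum_reflectionQuotient {ι : Type*} {f : ι → RealSpace N → ℂ} {F : RealSpace N → ℂ}
    {x : RealSpace N} (hf : ∀ z, HasSum (fun n => f n z) (F z))
    (hf' : HasSum (fun n => fderiv ℝ (f n) x) (fderiv ℝ F x)) (α : RealSpace N) :
    HasSum (fun n => reflectionQuotient α (f n) x) (reflectionQuotient α F x) := by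
  simp only [reflectionQuotient]
  split_ifs
  · exact (hf'.mapL (ContinuousLinearMap.apply ℝ ℂ α)).mul_left _
  · exact ((hf x).sub (hf _)).div_const _

theorem hasSum_dunklDifferential {ι : Type*} {f : ι → RealSpace N → ℂ} {F : RealSpace N → ℂ}
    {x : RealSpace N} (hf : ∀ z, HasSum (fun n => f n z) (F z))
    (hf' : HasSum (fun n => fderiv ℝ (f n) x) (fderiv ℝ F x)) :
    HasSum (fun n => dunklDifferential μ (f n) x) (dunklDifferential μ F x) :=
  hf'.add <| hasSum_sum fun α _ => (hasSum_reflectionQuotient hf hf' α.1).mapL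
    ((μ α / 2) • ContinuousLinearMap.smulRightL ℝ (RealSpace N) ℂ (innerSL ℝ α.1))

theorem IsRegular.reflectionQuotient_eq (hx : IsRegular R x) (α : R) (f : RealSpace N → ℂ) :
    reflectionQuotient α.1 f x = (⟪α.1, x⟫_ℝ)⁻¹ • (f x - f (rootReflection α.1 x)) := by
  rw [← inner_smul_reflectionQuotient, inv_smul_smul₀ (hx α α.2)]

theorem IsRegular.differentiableAt_reflectionQuotient (hx : IsRegular R x) (α : R)
    (hf : Differentiable ℝ f) : DifferentiableAt ℝ (reflectionQuotient α.1 f) x := by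
  have hev : reflectionQuotient α.1 f =ᶠ[𝓝 x]
      fun z => (⟪α.1, z⟫_ℝ)⁻¹ • (f z - f (rootReflection α.1 z)) :=
    hx.eventually.mono fun z hz => hz.reflectionQuotient_eq α f
  refine hev.differentiableAt_iff.2 (DifferentiableAt.fun_smul ?_ ?_)
  · exact (innerSL ℝ α.1).differentiableAt.inv (hx α α.2)
  · exact (hf x).sub ((hf _).comp x (rootReflection α.1).differentiableAt)

theorem IsRegular.dunklDifferential_eq (hx : IsRegular R x) (ξ : RealSpace N) :
    dunklDifferential μ f x ξ = fderiv ℝ f x ξ + dunklDifference μ ξ f x := by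
  rw [dunklDifferential_apply, dunklDifference_apply]
  refine congrArg _ (Finset.sum_congr rfl fun α _ => ?_)
  rw [hx.reflectionQuotient_eq, smul_smul, dunklWeight, mul_assoc, ← div_eq_mul_inv]

theorem IsRegular.dunklDifferential_congr (hR : IsRootSystem R) (hx : IsRegular R x)
    {g : RealSpace N → ℂ} (hfg : ∀ z, IsRegular R z → f z = g z) :
    dunklDifferential μ f x = dunklDifferential μ g x := by
  have hev : f =ᶠ[𝓝 x] g := hx.eventually.mono hfg
  rw [dunklDifferential, dunklDifferential, hev.fderiv_eq]
  congr 1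
  refine Finset.sum_congr rfl fun α _ => ?_
  rw [hx.reflectionQuotient_eq, hx.reflectionQuotient_eq, hfg x hx, hfg _ (hx.reflection hR α.2)]

theorem IsRegular.dunklDifferential_sub (hx : IsRegular R x) {g : RealSpace N → ℂ}
    (hf : DifferentiableAt ℝ f x) (hg : DifferentiableAt ℝ g x) :
    dunklDifferential μ (f - g) x = dunklDifferential μ f x - dunklDifferential μ g x := by
  ext ξ
  rw [sub_apply, hx.dunklDifferential_eq, hx.dunklDifferential_eq, hx.dunklDifferential_eq,
    map_sub, fderiv_sub hf hg]
  simp only [sub_apply, Pi.sub_apply]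
  ring

theorem IsRegular.dunklDifferential_const_smul (hx : IsRegular R x) (c : ℝ) :
    dunklDifferential μ (c • f) x = c • dunklDifferential μ f x := by
  ext ξ
  rw [smul_apply, hx.dunklDifferential_eq, hx.dunklDifferential_eq, map_smul,
    fderiv_const_smul_field, smul_add]
  rfl

theorem differentiable_fderiv_apply (hf : ContDiff ℝ 2 f) (ξ : RealSpace N) :
    Differentiable ℝ fun z => fderiv ℝ f z ξ :=
  ((hf.fderiv_right (m := 1) le_rfl).differentiable one_ne_zero).clm_apply
    (differentiable_const ξ)

theorem IsRegular.differentiableAt_dunklDifferential (hx : IsRegular R x) (hf : ContDiff ℝ 2 f) :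
    DifferentiableAt ℝ (dunklDifferential μ f) x :=
  ((hf.fderiv_right (m := 1) le_rfl).differentiable one_ne_zero x).add <|
    DifferentiableAt.fun_sum fun α _ => .fun_const_smul
      ((ContinuousLinearMap.smulRightL ℝ _ ℂ (innerSL ℝ α.1)).differentiableAt.comp x <|
        hx.differentiableAt_reflectionQuotient α (hf.differentiable two_ne_zero)) _

theorem IsRegular.dunklDifferential_comm (hR : IsRootSystem R) (hμ : IsMultiplicityFunction R μ)
    (hx : IsRegular R x) (hf : ContDiff ℝ 2 f) (ξ η : RealSpace N) :
    dunklDifferential μ (fun z => dunklDifferential μ f z ξ) x η =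
      dunklDifferential μ (fun z => dunklDifferential μ f z η) x ξ := by
  have hf1 : Differentiable ℝ f := hf.differentiable two_ne_zero
  have expand (ξ η : RealSpace N) :
      dunklDifferential μ (fun z => dunklDifferential μ f z ξ) x η =
        fderiv ℝ (fun z => fderiv ℝ f z ξ) x η +
          (fderiv ℝ (dunklDifference μ ξ f) x η +
            dunklDifference μ η (fun z => fderiv ℝ f z ξ) x) +
          dunklDifference μ η (dunklDifference μ ξ f) x := by
    rw [hx.dunklDifferential_congr hR (g := (fun z => fderiv ℝ f z ξ) + dunklDifference μ ξ f)
      fun z hz => hz.dunklDifferential_eq ξ, hx.dunklDifferential_eq, map_add,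
      fderiv_add (differentiable_fderiv_apply hf ξ x)
        (hasFDerivAt_dunklDifference hx hf1 ξ).differentiableAt]
    simp only [add_apply, Pi.add_apply]
    ring
  have hsymm : fderiv ℝ (fun z => fderiv ℝ f z ξ) x η = fderiv ℝ (fun z => fderiv ℝ f z η) x ξ := by
    have hd := ((hf.fderiv_right (m := 1) le_rfl).differentiable one_ne_zero) x
    simp only [fderiv_clm_apply hd (differentiableAt_const _), fderiv_fun_const]
    simpa using (hf.contDiffAt.isSymmSndFDerivAt (by simp)) η ξ
  rw [expand, expand, hsymm, fderiv_dunklDifference_add_comm hR hx hf1,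
    dunklDifference_comm hR hμ hx]

theorem fderiv_smul_of_homogeneous {m : ℕ} {s : ℝ} (hs : s ≠ 0)
    (hf : ∀ z, f (s • z) = s ^ (m + 1) • f z) (z : RealSpace N) :
    fderiv ℝ f (s • z) = s ^ m • fderiv ℝ f z := by
  have h : s • fderiv ℝ f (s • z) = s ^ (m + 1) • fderiv ℝ f z := by
    rw [← fderiv_comp_smul, show (fun z => f (s • z)) = s ^ (m + 1) • f from funext hf,
      fderiv_const_smul_field]
    rfl
  rw [← inv_smul_smul₀ hs (fderiv ℝ f (s • z)), h, smul_smul, pow_succ']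
  field_simp

theorem reflectionQuotient_smul_of_homogeneous {m : ℕ} {s : ℝ} (hs : s ≠ 0)
    (hf : ∀ z, f (s • z) = s ^ (m + 1) • f z) (α z : RealSpace N) :
    reflectionQuotient α f (s • z) = s ^ m • reflectionQuotient α f z := by
  simp only [reflectionQuotient, inner_smul_right, mul_eq_zero, hs, false_or]
  split_ifs with h
  · rw [fderiv_smul_of_homogeneous hs hf, smul_apply, mul_smul_comm]
  · have hα : (⟪α, z⟫_ℝ : ℂ) ≠ 0 := Complex.ofReal_ne_zero.2 h
    have hs' : (s : ℂ) ≠ 0 := Complex.ofReal_ne_zero.2 hs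
    simp only [map_smul, hf, Complex.real_smul]
    push_cast
    field_simp
    ring

theorem dunklDifferential_smul_of_homogeneous {m : ℕ} {s : ℝ} (hs : s ≠ 0)
    (hf : ∀ z, f (s • z) = s ^ (m + 1) • f z) (z : RealSpace N) :
    dunklDifferential μ f (s • z) = s ^ m • dunklDifferential μ f z := by
  ext ξ
  simp only [dunklDifferential_apply, fderiv_smul_of_homogeneous hs hf,
    reflectionQuotient_smul_of_homogeneous hs hf, smul_apply, smul_add, Finset.smul_sum,
    smul_comm (s ^ m)]

end Operators

/-! ### A maximum principle for weighted walks -/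

section Walk

variable {G ι F : Type*} [Fintype ι]

/-- The generator (with positive sign) of the walk on `G` that jumps from `g` to `p i g` at rate
`k i`. -/
def walkLaplacian [AddCommGroup F] [Module ℝ F] (k : ι → ℝ) (p : ι → G → G) :
    (G → F) →ₗ[ℝ] (G → F) :=
  ∑ i, k i • (LinearMap.id - LinearMap.funLeft ℝ F (p i))

theorem walkLaplacian_apply [AddCommGroup F] [Module ℝ F] (k : ι → ℝ) (p : ι → G → G) (u : G → F)
    (g : G) : walkLaplacian k p u g = ∑ i, k i • (u g - u (p i g)) := by
  simp only [walkLaplacian, LinearMap.sum_apply, Finset.sum_apply, LinearMap.smul_apply,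
    Pi.smul_apply, LinearMap.sub_apply, LinearMap.id_apply, Pi.sub_apply, LinearMap.funLeft_apply]

variable {k : ι → ℝ}

theorem sum_walkLaplacian_smul [AddCommGroup F] [Module ℝ F] [Fintype G] {p : ι → G → G}
    (hp : ∀ i, Function.Involutive (p i)) (c : G → ℝ) (φ : G → F) :
    ∑ g, walkLaplacian k p c g • φ g = ∑ g, c g • walkLaplacian k p φ g := by
  simp only [walkLaplacian_apply, Finset.sum_smul, Finset.smul_sum]
  refine Finset.sum_comm.trans <| (Finset.sum_congr rfl fun i _ => ?_).trans Finset.sum_comm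
  have hswap : ∑ g, c (p i g) • φ g = ∑ g, c g • φ (p i g) :=
    Finset.sum_equiv (hp i).toPerm (by simp) fun g _ => by simp [hp i g]
  simp only [smul_assoc, sub_smul, smul_comm _ (k i), ← Finset.smul_sum, smul_sub,
    Finset.sum_sub_distrib, hswap]

variable [Finite G] {p : ι → G → G} {r : ℝ}

theorem eq_zero_of_smul_add_walkLaplacian_eq_zero [NormedAddCommGroup F] [NormedSpace ℝ F]
    (hk : ∀ i, 0 ≤ k i) (hr : 0 < r) {u : G → F} (hu : r • u + walkLaplacian k p u = 0) :
    u = 0 := by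
  ext g
  have : Nonempty G := ⟨g⟩
  obtain ⟨m, hm⟩ := Finite.exists_max fun g => ‖u g‖
  suffices h0 : ‖u m‖ ≤ 0 from norm_le_zero_iff.1 ((hm g).trans h0)
  have hK : 0 ≤ ∑ i, k i := Finset.sum_nonneg fun i _ => hk i
  have hmean : (r + ∑ i, k i) • u m = ∑ i, k i • u (p i m) := by
    have := congrFun hu m
    simp only [Pi.add_apply, Pi.smul_apply, walkLaplacian_apply, smul_sub,
      Finset.sum_sub_distrib, ← Finset.sum_smul, Pi.zero_apply] at this
    rw [add_smul, ← sub_eq_zero, ← this]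
    abel
  have hle : (r + ∑ i, k i) * ‖u m‖ ≤ (∑ i, k i) * ‖u m‖ := by
    calc (r + ∑ i, k i) * ‖u m‖ = ‖(r + ∑ i, k i) • u m‖ := by
          rw [norm_smul, Real.norm_of_nonneg (by positivity)]
      _ ≤ ∑ i, ‖k i • u (p i m)‖ := by rw [hmean]; exact norm_sum_le _ _
      _ ≤ ∑ i, k i * ‖u m‖ := Finset.sum_le_sum fun i _ => by
          rw [norm_smul, Real.norm_of_nonneg (hk i)]
          exact mul_le_mul_of_nonneg_left (hm _) (hk i)
      _ = (∑ i, k i) * ‖u m‖ := (Finset.sum_mul _ _ _).symm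
  nlinarith [norm_nonneg (u m)]

theorem nonneg_of_smul_add_walkLaplacian_nonneg (hk : ∀ i, 0 ≤ k i) (hr : 0 < r) {u : G → ℝ}
    (hu : 0 ≤ r • u + walkLaplacian k p u) : 0 ≤ u := by
  intro g
  have : Nonempty G := ⟨g⟩
  obtain ⟨m, hm⟩ := Finite.exists_min u
  refine le_trans ?_ (hm g)
  have hjump : walkLaplacian k p u m ≤ 0 := by
    rw [walkLaplacian_apply]
    exact Finset.sum_nonpos fun i _ =>
      mul_nonpos_of_nonneg_of_nonpos (hk i) (sub_nonpos.2 (hm _))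
  have hum : 0 ≤ r * u m + walkLaplacian k p u m := hu m
  exact nonneg_of_mul_nonneg_right (a := r) (by linarith) hr

theorem exists_smul_add_walkLaplacian_eq (hk : ∀ i, 0 ≤ k i) (hr : 0 < r) (b : G → ℝ) :
    ∃ u : G → ℝ, r • u + walkLaplacian k p u = b := by
  have hinj : Function.Injective (r • LinearMap.id + walkLaplacian k p : (G → ℝ) →ₗ[ℝ] (G → ℝ)) :=
    (injective_iff_map_eq_zero _).2 fun u hu => eq_zero_of_smul_add_walkLaplacian_eq_zero hk hr hu
  exact LinearMap.injective_iff_surjective.1 hinj b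

end Walk

/-! ### The reflection group -/

section Group

variable {N : ℕ} {R : Finset (RealSpace N)}

theorem IsRootSystem.map_mem (hR : IsRootSystem R) (g : coxeterGroup R) {α : RealSpace N}
    (hα : α ∈ R) : g.1 α ∈ R := by
  obtain ⟨g, hg⟩ := g
  induction hg using Subgroup.closure_induction'' generalizing α with
  | mem g hg =>
    obtain ⟨β, hβ, rfl⟩ := hg
    exact hR.reflection_mem hβ hα
  | inv_mem g hg =>
    obtain ⟨β, hβ, rfl⟩ := hg
    exact hR.reflection_mem hβ hα
  | one => exact hα
  | mul _ _ _ _ hg hh => exact hg (hh hα)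

theorem apply_eq_self_of_forall_inner_eq_zero (g : coxeterGroup R) {v : RealSpace N}
    (hv : ∀ α ∈ R, ⟪α, v⟫_ℝ = 0) : g.1 v = v := by
  have hσ : ∀ α ∈ R, rootReflection α v = v := fun α hα => by
    rw [rootReflection_apply, hv α hα, mul_zero, zero_div, zero_smul, sub_zero]
  obtain ⟨g, hg⟩ := g
  induction hg using Subgroup.closure_induction'' with
  | mem g hg =>
    obtain ⟨α, hα, rfl⟩ := hg
    exact hσ α hα
  | inv_mem g hg =>
    obtain ⟨α, hα, rfl⟩ := hg
    exact hσ α hα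
  | one => rfl
  | mul g _ _ _ hg hh => exact (congrArg g hh).trans hg

theorem coxeterGroup_ext {g h : coxeterGroup R} (hgh : ∀ α ∈ R, g.1 α = h.1 α) : g = h := by
  have hlin : g.1.toLinearEquiv.toLinearMap = h.1.toLinearEquiv.toLinearMap := by
    refine LinearMap.ext_on_codisjoint (Submodule.isCompl_orthogonal
      (K := Submodule.span ℝ (R : Set (RealSpace N)))).codisjoint
      (LinearMap.eqOn_span hgh) fun v hv => ?_
    have hv' : ∀ α ∈ R, ⟪α, v⟫_ℝ = 0 := fun α hα => hv α (Submodule.subset_span hα)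
    exact (apply_eq_self_of_forall_inner_eq_zero g hv').trans
      (apply_eq_self_of_forall_inner_eq_zero h hv').symm
  exact Subtype.ext (LinearIsometryEquiv.ext fun x => DFunLike.congr_fun hlin x)

theorem IsRootSystem.finite_coxeterGroup (hR : IsRootSystem R) : Finite (coxeterGroup R) :=
  Finite.of_injective (fun (g : coxeterGroup R) (α : R) => (⟨g.1 α, hR.map_mem g α.2⟩ : R))
    fun _ _ hgh => coxeterGroup_ext fun α hα => congrArg Subtype.val (congrFun hgh ⟨α, hα⟩)

/-- The reflection `σ_α` as an element of the reflection group. -/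
def groupReflection (α : R) : coxeterGroup R :=
  ⟨rootReflection α.1, Subgroup.subset_closure ⟨α, α.2, rfl⟩⟩

@[simp]
theorem groupReflection_mul_apply (α : R) (g : coxeterGroup R) (x : RealSpace N) :
    (groupReflection α * g).1 x = rootReflection α.1 (g.1 x) := rfl

theorem IsRegular.map (hR : IsRootSystem R) {x : RealSpace N} (hx : IsRegular R x)
    (g : coxeterGroup R) : IsRegular R (g.1 x) := by
  intro α hα
  rw [← g.1.symm.inner_map_map, g.1.symm_apply_apply]
  exact hx _ (hR.map_mem g⁻¹ hα)

end Group

/-! ### Closed one-forms for the Dunkl operators -/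

section ClosedForms

theorem fderiv_apply_self_of_homogeneous {E F : Type*} [NormedAddCommGroup E] [NormedSpace ℝ E]
    [NormedAddCommGroup F] [NormedSpace ℝ F] {f : E → F} {x : E} {m : ℕ}
    (hf : DifferentiableAt ℝ f x) (hm : ∀ s : ℝ, s ≠ 0 → f (s • x) = s ^ m • f x) :
    fderiv ℝ f x x = (m : ℝ) • f x := by
  have hpow : HasDerivAt (fun s : ℝ => s ^ m • f x) ((m : ℝ) • f x) 1 := by
    simpa using (hasDerivAt_pow m (1 : ℝ)).smul_const (f x)
  have hline : HasDerivAt (fun s : ℝ => f (s • x)) (fderiv ℝ f x x) 1 := by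
    have hx : HasDerivAt (fun s : ℝ => s • x) x 1 := by
      simpa using (hasDerivAt_id (1 : ℝ)).smul_const x
    exact HasFDerivAt.comp_hasDerivAt_of_eq 1 hf.hasFDerivAt hx (one_smul ℝ x).symm
  exact hline.unique <| hpow.congr_of_eventuallyEq <|
    (isOpen_ne.eventually_mem one_ne_zero).mono fun s hs => hm s hs

variable {N : ℕ} {R : Finset (RealSpace N)} {μ : R → ℝ}
  {ω : RealSpace N → RealSpace N →L[ℝ] ℂ} {m : ℕ} {x : RealSpace N}

theorem fderiv_apply_self_of_apply_self_eq_zero (hd : DifferentiableAt ℝ ω x)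
    (hzero : ∀ z, ω z z = 0) (η : RealSpace N) :
    fderiv ℝ ω x η x = -ω x η := by
  have h : fderiv ℝ (fun z => ω z z) x = 0 := by rw [funext hzero, fderiv_fun_const]; rfl
  rw [fderiv_clm_apply hd differentiableAt_fun_id] at h
  have hη := DFunLike.congr_fun h η
  simp only [add_apply, ContinuousLinearMap.comp_apply, ContinuousLinearMap.flip_apply,
    fderiv_fun_id, ContinuousLinearMap.id_apply, zero_apply] at hη
  exact eq_neg_of_add_eq_zero_right hη

/-- `ω` satisfies `T_η ω_ξ = T_ξ ω_η` at all regular points: the analogue of closedness for a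
one-form, with the Dunkl operators in place of the partial derivatives. -/
def IsDunklClosed (μ : R → ℝ) (ω : RealSpace N → RealSpace N →L[ℝ] ℂ) : Prop :=
  ∀ x, IsRegular R x → ∀ ξ η,
    dunklDifferential μ (fun z => ω z ξ) x η = dunklDifferential μ (fun z => ω z η) x ξ

theorem apply_reflection_of_apply_self_eq_zero (hR : IsRootSystem R) (hzero : ∀ z, ω z z = 0)
    (α : R) (x : RealSpace N) :
    ω (rootReflection α.1 x) x = ⟪α.1, x⟫_ℝ • ω (rootReflection α.1 x) α.1 := by
  have hx : x = rootReflection α.1 x + ⟪α.1, x⟫_ℝ • α.1 := by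
    rw [hR.reflection_apply, sub_add_cancel]
  conv_lhs => rw [congrArg (ω (rootReflection α.1 x)) hx, map_add, hzero, zero_add, map_smul]

theorem IsDunklClosed.smul_add_sum_eq_zero (hR : IsRootSystem R) (hω : IsDunklClosed μ ω)
    (hzero : ∀ z, ω z z = 0) (hm : ∀ s : ℝ, s ≠ 0 → ω (s • x) = s ^ m • ω x)
    (hx : IsRegular R x) (hd : DifferentiableAt ℝ ω x) (η : RealSpace N) :
    (m + 1 : ℝ) • ω x η + ∑ α : R, (μ α / 2) •
      (ω x η - ω (rootReflection α.1 x) (rootReflection α.1 η)) = 0 := by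
  have happly (ξ η : RealSpace N) : fderiv ℝ (fun z => ω z ξ) x η = fderiv ℝ ω x η ξ := by
    simp [fderiv_clm_apply hd (differentiableAt_const ξ)]
  have hleft : dunklDifferential μ (fun z => ω z x) x η =
      -ω x η - ∑ α : R, (μ α / 2 * ⟪α.1, η⟫_ℝ) • ω (rootReflection α.1 x) α.1 := by
    rw [hx.dunklDifferential_eq, happly, fderiv_apply_self_of_apply_self_eq_zero hd hzero,
      dunklDifference_apply, sub_eq_add_neg, ← Finset.sum_neg_distrib]
    refine congrArg _ (Finset.sum_congr rfl fun α _ => ?_)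
    have hα := hx α α.2
    rw [hzero, apply_reflection_of_apply_self_eq_zero hR hzero, zero_sub, smul_neg, smul_smul,
      dunklWeight]
    field_simp
  have hright : dunklDifferential μ (fun z => ω z η) x x =
      (m : ℝ) • ω x η + ∑ α : R, (μ α / 2) • (ω x η - ω (rootReflection α.1 x) η) := by
    rw [dunklDifferential_apply_self, happly, fderiv_apply_self_of_homogeneous hd hm, smul_apply]
  have h := hω x hx x η
  rw [hleft, hright, sub_eq_iff_eq_add] at h
  have hsplit : ∑ α : R, (μ α / 2) • (ω x η - ω (rootReflection α.1 x) (rootReflection α.1 η)) =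
      ∑ α : R, (μ α / 2) • (ω x η - ω (rootReflection α.1 x) η) +
        ∑ α : R, (μ α / 2 * ⟪α.1, η⟫_ℝ) • ω (rootReflection α.1 x) α.1 := by
    rw [← Finset.sum_add_distrib]
    refine Finset.sum_congr rfl fun α _ => ?_
    rw [hR.reflection_apply α η, map_sub, map_smul]
    module
  rw [hsplit]
  linear_combination (norm := module) -h

theorem IsDunklClosed.eq_zero (hR : IsRootSystem R) (hμ_nonneg : ∀ α, 0 ≤ μ α)
    (hω : IsDunklClosed μ ω) (hzero : ∀ z, ω z z = 0)
    (hm : ∀ s : ℝ, s ≠ 0 → ∀ z, ω (s • z) = s ^ m • ω z)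
    (hd : ∀ z, IsRegular R z → DifferentiableAt ℝ ω z) (hx : IsRegular R x) : ω x = 0 := by
  ext η
  have : Finite (coxeterGroup R) := hR.finite_coxeterGroup
  have hwalk := eq_zero_of_smul_add_walkLaplacian_eq_zero (r := m + 1)
    (k := fun α : R => μ α / 2) (p := fun α g => groupReflection α * g)
    (u := fun g : coxeterGroup R => ω (g.1 x) (g.1 η))
    (fun α => div_nonneg (hμ_nonneg α) two_pos.le) (by positivity) <| funext fun g => by
      have hg := hx.map hR g
      simpa only [Pi.add_apply, Pi.smul_apply, walkLaplacian_apply, groupReflection_mul_apply,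
        Pi.zero_apply] using
        hω.smul_add_sum_eq_zero hR hzero (fun s hs => hm s hs _) hg (hd _ hg) (g.1 η)
  exact congrFun hwalk 1

end ClosedForms

/-! ### Continuity across the walls -/

section Walls

variable {N : ℕ} {R : Finset (RealSpace N)} {μ : R → ℝ} {f : RealSpace N → ℂ} {y : RealSpace N}

theorem reflectionQuotient_eq_integral {α : RealSpace N} (hf : ContDiff ℝ 1 f) (x : RealSpace N) :
    reflectionQuotient α f x =
      (2 / ‖α‖ ^ 2) • ∫ s in (0 : ℝ)..1, fderiv ℝ f (x - (s * (2 * ⟪α, x⟫_ℝ / ‖α‖ ^ 2)) • α) α := by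
  set c : ℝ := 2 * ⟪α, x⟫_ℝ / ‖α‖ ^ 2 with hc
  by_cases hα : ⟪α, x⟫_ℝ = 0
  · rw [reflectionQuotient, if_pos hα, hc, hα, mul_zero, zero_div]
    simp
  · have hderiv (s : ℝ) : HasDerivAt (fun s : ℝ => f (x - (s * c) • α))
        (-(c • fderiv ℝ f (x - (s * c) • α) α)) s := by
      have hline : HasDerivAt (fun s : ℝ => x - (s * c) • α) (-(c • α)) s := by
        simpa using (((hasDerivAt_id s).mul_const c).smul_const α).const_sub x
      rw [← map_smul, ← map_neg]
      exact (hf.differentiable one_ne_zero _).hasFDerivAt.comp_hasDerivAt s hline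
    have hcont : Continuous fun s : ℝ => fderiv ℝ f (x - (s * c) • α) α :=
      ((hf.continuous_fderiv one_ne_zero).comp (by fun_prop)).clm_apply continuous_const
    have hint := intervalIntegral.integral_eq_sub_of_hasDerivAt (fun s _ => hderiv s)
      ((hcont.const_smul c).neg.intervalIntegrable 0 1)
    rw [intervalIntegral.integral_neg, intervalIntegral.integral_smul, one_mul, zero_mul, zero_smul,
      sub_zero, hc, ← rootReflection_apply, ← hc, neg_eq_iff_eq_neg, neg_sub,
      ← inner_smul_reflectionQuotient] at hint
    rw [← inv_smul_smul₀ hα (reflectionQuotient α f x), ← hint, smul_smul, hc]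
    congr 1
    field_simp

theorem continuous_reflectionQuotient (hf : ContDiff ℝ 1 f) (α : RealSpace N) :
    Continuous (reflectionQuotient α f) := by
  rw [funext (reflectionQuotient_eq_integral hf)]
  have hderiv : Continuous (Function.uncurry fun (x : RealSpace N) (s : ℝ) =>
      fderiv ℝ f (x - (s * (2 * ⟪α, x⟫_ℝ / ‖α‖ ^ 2)) • α) α) :=
    ((hf.continuous_fderiv one_ne_zero).comp (by fun_prop)).clm_apply continuous_const
  exact (intervalIntegral.continuous_parametric_intervalIntegral_of_continuous'
    (μ := MeasureTheory.volume) hderiv 0 1).const_smul (2 / ‖α‖ ^ 2)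

theorem continuous_dunklDifferential (hf : ContDiff ℝ 1 f) :
    Continuous (dunklDifferential μ f) :=
  (hf.continuous_fderiv one_ne_zero).add <| continuous_finsetSum _ fun α _ => .fun_const_smul
    ((ContinuousLinearMap.smulRightL ℝ _ ℂ (innerSL ℝ α.1)).continuous.comp
      (continuous_reflectionQuotient hf α)) _

theorem isDunklClosed_dunklDifferential_sub (hR : IsRootSystem R)
    (hμ : IsMultiplicityFunction R μ) {h : RealSpace N → ℂ} (hf : ContDiff ℝ 2 f)
    (hh : Differentiable ℝ h)
    (hgrad : ∀ x, ∃ a : ℂ, dunklDifferential μ h x = (innerSL ℝ y).smulRight a) :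
    IsDunklClosed μ fun x => dunklDifferential μ f x - (innerSL ℝ y).smulRight (h x) := by
  intro x hx ξ η
  obtain ⟨a, ha⟩ := hgrad x
  have expand (ξ η : RealSpace N) :
      dunklDifferential μ
          (fun z => (dunklDifferential μ f z - (innerSL ℝ y).smulRight (h z)) ξ) x η =
        dunklDifferential μ (fun z => dunklDifferential μ f z ξ) x η -
          ⟪y, ξ⟫_ℝ • ⟪y, η⟫_ℝ • a := by
    have hd := (hx.differentiableAt_dunklDifferential (μ := μ) hf).clm_apply
      (differentiableAt_const ξ)
    rw [show (fun z => (dunklDifferential μ f z - (innerSL ℝ y).smulRight (h z)) ξ) =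
        (fun z => dunklDifferential μ f z ξ) - ⟪y, ξ⟫_ℝ • h from rfl,
      hx.dunklDifferential_sub hd ((hh x).const_smul _), hx.dunklDifferential_const_smul, ha]
    rfl
  rw [expand, expand, hx.dunklDifferential_comm hR hμ hf, smul_comm]

theorem dunklDifferential_eq_smulRight (hR : IsRootSystem R) (hμ : IsMultiplicityFunction R μ)
    (hμ_nonneg : ∀ α, 0 ≤ μ α) {h : RealSpace N → ℂ} (hf : ContDiff ℝ 2 f)
    (hh : Differentiable ℝ h) {m : ℕ} (hfm : ∀ (s : ℝ) z, f (s • z) = s ^ (m + 1) • f z)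
    (hhm : ∀ (s : ℝ) z, h (s • z) = s ^ m • h z)
    (hradial : ∀ x, dunklDifferential μ f x x = ⟪y, x⟫_ℝ • h x)
    (hgrad : ∀ x, ∃ a : ℂ, dunklDifferential μ h x = (innerSL ℝ y).smulRight a)
    (x : RealSpace N) : dunklDifferential μ f x = (innerSL ℝ y).smulRight (h x) := by
  have hregular : Set.EqOn (dunklDifferential μ f) (fun x => (innerSL ℝ y).smulRight (h x))
      {x | IsRegular R x} := fun x hx => by
    refine sub_eq_zero.1 <| (isDunklClosed_dunklDifferential_sub hR hμ hf hh hgrad).eq_zero (m := m)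
      hR hμ_nonneg (fun z => ?_) (fun s hs z => ?_) (fun z hz => ?_) hx
    · rw [sub_apply, hradial, ContinuousLinearMap.smulRight_apply, innerSL_apply_apply, sub_self]
    · rw [dunklDifferential_smul_of_homogeneous hs (hfm s), hhm, smul_sub]
      ext ξ
      simp only [sub_apply, smul_apply, ContinuousLinearMap.smulRight_apply]
      rw [smul_comm]
    · exact (hz.differentiableAt_dunklDifferential hf).sub
        ((ContinuousLinearMap.smulRightL ℝ _ ℂ (innerSL ℝ y)).differentiableAt.comp z (hh z))
  refine congrFun (Continuous.ext_on hR.dense_setOf_isRegular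
    (continuous_dunklDifferential (hf.of_le one_le_two)) ?_ hregular) x
  exact (ContinuousLinearMap.smulRightL ℝ _ ℂ (innerSL ℝ y)).continuous.comp hh.continuous

end Walls

/-! ### Complexification -/

section Complexification

variable {N : ℕ}

/-- The inclusion `ℝ^N → ℂ^N` as a continuous real-linear map. -/
def toComplexL (N : ℕ) : RealSpace N →L[ℝ] ComplexSpace N :=
  LinearMap.toContinuousLinearMap
    { toFun := toComplex
      map_add' := fun x y => by ext j; simp [toComplex]
      map_smul' := fun r x => by ext j; simp [toComplex] }

@[simp]
theorem toComplexL_apply (x : RealSpace N) : toComplexL N x = toComplex x := rfl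

theorem toComplex_zero : toComplex (0 : RealSpace N) = 0 := map_zero (toComplexL N)

theorem toComplex_add (x y : RealSpace N) : toComplex (x + y) = toComplex x + toComplex y :=
  map_add (toComplexL N) x y

theorem toComplex_smul (r : ℝ) (x : RealSpace N) : toComplex (r • x) = (r : ℂ) • toComplex x :=
  (map_smul (toComplexL N) r x).trans (Complex.coe_smul r _).symm

theorem exists_eq_toComplex_add (z : ComplexSpace N) :
    ∃ a b : RealSpace N, z = toComplex a + Complex.I • toComplex b := by
  refine ⟨WithLp.toLp 2 fun j => (z j).re, WithLp.toLp 2 fun j => (z j).im, ?_⟩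
  ext j
  simp [toComplex, mul_comm Complex.I]

theorem norm_sq_toComplex_add (a b : RealSpace N) :
    ‖toComplex a + Complex.I • toComplex b‖ ^ 2 = ‖a‖ ^ 2 + ‖b‖ ^ 2 := by
  simp only [EuclideanSpace.norm_sq_eq, ← Finset.sum_add_distrib]
  refine Finset.sum_congr rfl fun j _ => ?_
  rw [Complex.sq_norm, Complex.normSq_apply]
  simp [toComplex, sq]

/-- The complex-linear extension to `ℂ^N` of an isometry of `ℝ^N`. -/
def complexify (g : RealSpace N ≃ₗᵢ[ℝ] RealSpace N) : ComplexSpace N →L[ℂ] ComplexSpace N :=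
  ∑ j, (EuclideanSpace.proj j : ComplexSpace N →L[ℂ] ℂ).smulRight
    (toComplex (g (EuclideanSpace.single j 1)))

@[simp]
theorem complexify_toComplex (g : RealSpace N ≃ₗᵢ[ℝ] RealSpace N) (x : RealSpace N) :
    complexify g (toComplex x) = toComplex (g x) := by
  have hx : x = ∑ j, x j • EuclideanSpace.single j (1 : ℝ) := by
    simpa using ((EuclideanSpace.basisFun (Fin N) ℝ).sum_repr x).symm
  conv_rhs => rw [hx, ← toComplexL_apply, map_sum, map_sum]
  simp only [complexify, sum_apply, ContinuousLinearMap.smulRight_apply, map_smul,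
    toComplexL_apply]
  rfl

theorem norm_complexify (g : RealSpace N ≃ₗᵢ[ℝ] RealSpace N) (z : ComplexSpace N) :
    ‖complexify g z‖ = ‖z‖ := by
  obtain ⟨a, b, rfl⟩ := exists_eq_toComplex_add z
  rw [← sq_eq_sq₀ (norm_nonneg _) (norm_nonneg _), map_add, map_smul, complexify_toComplex,
    complexify_toComplex, norm_sq_toComplex_add, norm_sq_toComplex_add, g.norm_map, g.norm_map]

/-- The bilinear (not Hermitian) pairing `∑ j, z_j w_j` on `ℂ^N`, as a function of `(z, w)`. -/
def pairing (p : ComplexSpace N × ComplexSpace N) : ℂ := ∑ j, p.1 j * p.2 j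

theorem pairing_smul_left (s : ℂ) (z w : ComplexSpace N) :
    pairing (s • z, w) = s * pairing (z, w) := by
  simp [pairing, Finset.mul_sum, mul_assoc]

theorem pairing_toComplex (x y : RealSpace N) :
    pairing (toComplex x, toComplex y) = (⟪y, x⟫_ℝ : ℂ) := by
  simp [pairing, toComplex, PiLp.inner_apply]

theorem bilinSq_toComplex (x : RealSpace N) : bilinSq (toComplex x) = ((‖x‖ ^ 2 : ℝ) : ℂ) := by
  simp [bilinSq, toComplex, EuclideanSpace.norm_sq_eq]

theorem norm_pairing_le (p : ComplexSpace N × ComplexSpace N) :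
    ‖pairing p‖ ≤ ‖p.1‖ * ‖p.2‖ := by
  calc ‖pairing p‖ ≤ ∑ j, ‖p.1 j‖ * ‖p.2 j‖ :=
        (norm_sum_le _ _).trans_eq (Finset.sum_congr rfl fun j _ => norm_mul _ _)
    _ ≤ √(∑ j, ‖p.1 j‖ ^ 2) * √(∑ j, ‖p.2 j‖ ^ 2) := Real.sum_mul_le_sqrt_mul_sqrt _ _ _
    _ = ‖p.1‖ * ‖p.2‖ := by rw [EuclideanSpace.norm_eq, EuclideanSpace.norm_eq]

theorem contDiff_pairing {n : WithTop ℕ∞} :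
    ContDiff ℂ n (pairing : ComplexSpace N × ComplexSpace N → ℂ) :=
  ContDiff.sum fun j _ =>
    ((EuclideanSpace.proj j : ComplexSpace N →L[ℂ] ℂ).contDiff.comp contDiff_fst).mul
      ((EuclideanSpace.proj j : ComplexSpace N →L[ℂ] ℂ).contDiff.comp contDiff_snd)

theorem differentiable_bilinSq : Differentiable ℂ (bilinSq : ComplexSpace N → ℂ) :=
  Differentiable.fun_sum fun j _ =>
    (EuclideanSpace.proj j : ComplexSpace N →L[ℂ] ℂ).differentiable.pow 2

end Complexification

/-! ### Entire functions of several variables -/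

section Entire

variable {E F : Type*} [NormedAddCommGroup E] [NormedSpace ℂ E] [NormedAddCommGroup F]
  [NormedSpace ℂ F]

theorem norm_fderiv_le_of_norm_le {f : E → F} (hf : Differentiable ℂ f) {x : E} {C : ℝ}
    (hC : ∀ z ∈ Metric.closedBall x 1, ‖f z‖ ≤ C) : ‖fderiv ℂ f x‖ ≤ C := by
  have hC_nonneg : 0 ≤ C := (norm_nonneg _).trans (hC x (Metric.mem_closedBall_self zero_le_one))
  refine ContinuousLinearMap.opNorm_le_bound _ hC_nonneg fun v => ?_
  rcases eq_or_ne v 0 with rfl | hv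
  · simp
  have hv_pos : 0 < ‖v‖ := norm_pos_iff.2 hv
  have hderiv (s : ℂ) :
      HasDerivAt (fun s : ℂ => f (x + s • v)) (fderiv ℂ f (x + s • v) v) s := by
    have hline : HasDerivAt (fun s : ℂ => x + s • v) v s := by
      simpa using ((hasDerivAt_id s).smul_const v).const_add x
    exact (hf _).hasFDerivAt.comp_hasDerivAt s hline
  have hcauchy := Complex.norm_deriv_le_of_forall_mem_sphere_norm_le (c := 0) (inv_pos.2 hv_pos)
    (f := fun s : ℂ => f (x + s • v)) (C := C)
    (Differentiable.diffContOnCl fun s => (hderiv s).differentiableAt) fun s hs => hC _ <| by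
      rw [Metric.mem_closedBall, dist_self_add_left, norm_smul, mem_sphere_zero_iff_norm.1 hs,
        inv_mul_cancel₀ hv_pos.ne']
  rwa [(hderiv 0).deriv, zero_smul, add_zero, div_inv_eq_mul] at hcauchy

theorem summable_fderiv_of_norm_le [CompleteSpace F] {f : ℕ → E → F}
    (hf : ∀ n, Differentiable ℂ (f n)) {u : ℕ → ℝ} (hu : Summable u) {x : E}
    (hfu : ∀ n, ∀ z ∈ Metric.closedBall x 1, ‖f n z‖ ≤ u n) : Summable fun n => fderiv ℂ (f n) x :=
  .of_norm_bounded hu fun n => norm_fderiv_le_of_norm_le (hf n) (hfu n)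

theorem hasFDerivAt_tsum_of_norm_le [CompleteSpace F] {f : ℕ → E → F}
    (hf : ∀ n, Differentiable ℂ (f n)) {u : ℕ → ℝ} (hu : Summable u) {x : E}
    (hfu : ∀ n, ∀ z ∈ Metric.closedBall x 2, ‖f n z‖ ≤ u n) :
    HasFDerivAt (fun z => ∑' n, f n z) (∑' n, fderiv ℂ (f n) x) x := by
  have hx : x ∈ Metric.ball x 1 := Metric.mem_ball_self one_pos
  have hbound (n : ℕ) (z : E) (hz : z ∈ Metric.ball x 1) : ‖fderiv ℂ (f n) z‖ ≤ u n :=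
    norm_fderiv_le_of_norm_le (hf n) fun w hw => hfu n w <|
      Metric.closedBall_subset_closedBall' (by linarith [Metric.mem_ball.1 hz]) hw
  exact hasFDerivAt_tsum_of_isPreconnected hu Metric.isOpen_ball (convex_ball x 1).isPreconnected
    (fun n z _ => (hf n z).hasFDerivAt) hbound hx
    (.of_norm_bounded hu fun n => hfu n x (Metric.mem_closedBall_self two_pos.le)) hx

theorem hasSum_restrictScalars_comp {G : Type*} [NormedAddCommGroup G] [NormedSpace ℝ G]
    (L : G →L[ℝ] E) {f : ℕ → E →L[ℂ] F} {f' : E →L[ℂ] F} (h : HasSum f f') :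
    HasSum (fun n => ((f n).restrictScalars ℝ).comp L) ((f'.restrictScalars ℝ).comp L) :=
  (h.mapL (ContinuousLinearMap.restrictScalarsL ℂ E F ℝ ℝ)).mapL (ContinuousLinearMap.precomp F L)

theorem fderiv_left_toComplex {N : ℕ} {f : ComplexSpace N × ComplexSpace N → ℂ}
    {f' : ComplexSpace N × ComplexSpace N →L[ℂ] ℂ} {x y : RealSpace N}
    (hf : HasFDerivAt f f' (toComplex x, toComplex y)) :
    fderiv ℝ (fun x => f (toComplex x, toComplex y)) x =
      (f'.restrictScalars ℝ).comp ((toComplexL N).prod 0) :=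
  ((hf.restrictScalars ℝ).comp x
    ((toComplexL N).hasFDerivAt.prodMk (hasFDerivAt_const (toComplex y) x))).fderiv

theorem apply_add_smul_eq_of_forall_ofReal [CompleteSpace F] {f g : E → F}
    (hf : Differentiable ℂ f) (hg : Differentiable ℂ g) {a b : E}
    (h : ∀ s : ℝ, f (a + (s : ℂ) • b) = g (a + (s : ℂ) • b)) (ζ : ℂ) :
    f (a + ζ • b) = g (a + ζ • b) := by
  have hline : Differentiable ℂ fun s : ℂ => a + s • b := by fun_prop
  have hreal : Tendsto (fun s : ℝ => (s : ℂ)) (𝓝[≠] 0) (𝓝[≠] 0) :=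
    tendsto_nhdsWithin_iff.2
      ⟨(Complex.continuous_ofReal.tendsto' 0 0 Complex.ofReal_zero).mono_left nhdsWithin_le_nhds,
        eventually_mem_nhdsWithin.mono fun _ => Complex.ofReal_ne_zero.2⟩
  exact congrFun (AnalyticOnNhd.eq_of_frequently_eq (z₀ := 0)
    (fun s _ => (hf.comp hline).analyticAt s) (fun s _ => (hg.comp hline).analyticAt s)
    (hreal.frequently (Frequently.of_forall h))) ζ

theorem IsHolomorphic.ext_real {N : ℕ} {F G : ComplexSpace N → ComplexSpace N → ℂ}
    (hF : IsHolomorphic F) (hG : IsHolomorphic G)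
    (h : ∀ x y : RealSpace N, F (toComplex x) (toComplex y) = G (toComplex x) (toComplex y)) :
    F = G := by
  ext z w
  obtain ⟨a, b, rfl⟩ := exists_eq_toComplex_add z
  obtain ⟨c, d, rfl⟩ := exists_eq_toComplex_add w
  refine apply_add_smul_eq_of_forall_ofReal hF hG (a := (toComplex a, toComplex c))
    (b := (toComplex b, toComplex d)) (fun s => ?_) Complex.I
  simp only [Prod.smul_mk, Prod.mk_add_mk, ← toComplex_smul, ← toComplex_add, h]

end Entire

/-! ### The homogeneous components of the Dunkl kernel -/

section Components

variable {N : ℕ} {R : Finset (RealSpace N)} {μ : R → ℝ}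

open Classical in
/-- `c` solves the resolvent equation `r c + L c = δ₁` on the reflection group. For `r = n`
averaging with the weights `c` inverts the radial Dunkl operator `∑ j, x_j T_j` on homogeneous
functions of degree `n`. -/
def IsAveragingWeight (μ : R → ℝ) (r : ℝ) (c : coxeterGroup R → ℝ) : Prop :=
  r • c + walkLaplacian (fun α => μ α / 2) (fun α g => g * groupReflection α) c = Pi.single 1 1

theorem exists_isAveragingWeight [Finite (coxeterGroup R)] (hμ_nonneg : ∀ α, 0 ≤ μ α) {r : ℝ}
    (hr : 0 < r) : ∃ c, IsAveragingWeight μ r c :=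
  exists_smul_add_walkLaplacian_eq (fun α => div_nonneg (hμ_nonneg α) two_pos.le) hr _

open Classical in
theorem IsAveragingWeight.nonneg [Finite (coxeterGroup R)] (hμ_nonneg : ∀ α, 0 ≤ μ α) {r : ℝ}
    (hr : 0 < r) {c : coxeterGroup R → ℝ} (hc : IsAveragingWeight μ r c) : 0 ≤ c :=
  nonneg_of_smul_add_walkLaplacian_nonneg (fun α => div_nonneg (hμ_nonneg α) two_pos.le) hr <|
    (Pi.single_nonneg.2 zero_le_one).trans_eq hc.symm

theorem groupReflection_mul_self (α : R) : groupReflection α * groupReflection α = 1 :=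
  Subtype.ext (Submodule.reflection_mul_reflection _)

variable [Fintype (coxeterGroup R)]

theorem IsAveragingWeight.smul_sum_add {F : Type*} [AddCommGroup F] [Module ℝ F] {r : ℝ}
    {c : coxeterGroup R → ℝ} (hc : IsAveragingWeight μ r c) (φ : coxeterGroup R → F) :
    r • ∑ g, c g • φ g +
      ∑ α : R, (μ α / 2) • (∑ g, c g • φ g - ∑ g, c g • φ (g * groupReflection α)) = φ 1 := by
  have hinv (α : R) : Function.Involutive fun g : coxeterGroup R => g * groupReflection α :=
    fun g => by simp only [mul_assoc, groupReflection_mul_self, mul_one]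
  have hcomm : ∑ α : R, (μ α / 2) • (∑ g, c g • φ g - ∑ g, c g • φ (g * groupReflection α)) =
      ∑ g, c g • walkLaplacian (fun α => μ α / 2) (fun α g => g * groupReflection α) φ g := by
    simp only [walkLaplacian_apply, ← Finset.sum_sub_distrib, ← smul_sub, Finset.smul_sum]
    rw [Finset.sum_comm]
    simp only [smul_comm (c _)]
  have hsum := congrArg (fun u : coxeterGroup R → ℝ => ∑ g, u g • φ g) hc
  simp only [Pi.add_apply, Pi.smul_apply, add_smul, smul_assoc, Finset.sum_add_distrib,
    sum_walkLaplacian_smul hinv, Pi.single_apply, ite_smul, one_smul, zero_smul,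
    Finset.sum_ite_eq', Finset.mem_univ, if_true] at hsum
  rw [hcomm, Finset.smul_sum, hsum]

theorem IsAveragingWeight.mul_sum_eq_one {r : ℝ} {c : coxeterGroup R → ℝ}
    (hc : IsAveragingWeight μ r c) : r * ∑ g, c g = 1 := by
  simpa using hc.smul_sum_add fun _ => (1 : ℝ)

/-- The `n`-th homogeneous component of the Dunkl kernel, as a function of `(z, w)`: the function
`⟨z, w⟩` times the previous component is averaged over the reflection group with the
weights `c n`. -/
def kernelTerm (c : ℕ → coxeterGroup R → ℝ) : ℕ → ComplexSpace N × ComplexSpace N → ℂ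
  | 0, _ => 1
  | n + 1, p => ∑ g, c n g •
      (pairing (complexify g.1 p.1, p.2) * kernelTerm c n (complexify g.1 p.1, p.2))

theorem contDiff_kernelTerm (c : ℕ → coxeterGroup R → ℝ) {k : WithTop ℕ∞} (n : ℕ) :
    ContDiff ℂ k (kernelTerm c n) := by
  induction n with
  | zero => exact contDiff_const
  | succ n ih =>
    refine ContDiff.sum fun g _ => ContDiff.const_smul (c n g) ?_
    have hg : ContDiff ℂ k fun p : ComplexSpace N × ComplexSpace N =>
        (complexify g.1 p.1, p.2) :=
      ((complexify g.1).contDiff.comp contDiff_fst).prodMk contDiff_snd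
    exact (contDiff_pairing.comp hg).mul (ih.comp hg)

theorem differentiable_kernelTerm (c : ℕ → coxeterGroup R → ℝ) (n : ℕ) :
    Differentiable ℂ (kernelTerm c n) :=
  (contDiff_kernelTerm c (k := 1) n).differentiable one_ne_zero

theorem contDiff_kernelTerm_toComplex (c : ℕ → coxeterGroup R → ℝ) {k : WithTop ℕ∞} (n : ℕ)
    (y : RealSpace N) :
    ContDiff ℝ k fun x : RealSpace N => kernelTerm c n (toComplex x, toComplex y) :=
  ((contDiff_kernelTerm c n).restrict_scalars ℝ).comp
    ((toComplexL N).contDiff.prodMk contDiff_const)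

theorem kernelTerm_smul_left (c : ℕ → coxeterGroup R → ℝ) (n : ℕ) (s : ℂ) (z w : ComplexSpace N) :
    kernelTerm c n (s • z, w) = s ^ n * kernelTerm c n (z, w) := by
  induction n generalizing z with
  | zero => simp [kernelTerm]
  | succ n ih =>
    simp only [kernelTerm, map_smul, ih, pairing_smul_left, Finset.mul_sum]
    refine Finset.sum_congr rfl fun g _ => ?_
    rw [mul_smul_comm]
    ring_nf

theorem kernelTerm_toComplex_smul (c : ℕ → coxeterGroup R → ℝ) (n : ℕ) (s : ℝ)
    (x y : RealSpace N) :
    kernelTerm c n (toComplex (s • x), toComplex y) =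
      s ^ n • kernelTerm c n (toComplex x, toComplex y) := by
  rw [toComplex_smul, kernelTerm_smul_left, Complex.real_smul, Complex.ofReal_pow]

theorem im_kernelTerm (c : ℕ → coxeterGroup R → ℝ) (n : ℕ) (x y : RealSpace N) :
    (kernelTerm c n (toComplex x, toComplex y)).im = 0 := by
  induction n generalizing x with
  | zero => simp [kernelTerm]
  | succ n ih =>
    simp only [kernelTerm, complexify_toComplex, pairing_toComplex, Complex.im_sum,
      Complex.smul_im, Complex.im_ofReal_mul, ih, mul_zero, smul_zero, Finset.sum_const_zero]

variable {c : ℕ → coxeterGroup R → ℝ}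

theorem norm_kernelTerm_le (hμ_nonneg : ∀ α, 0 ≤ μ α)
    (hc : ∀ n : ℕ, IsAveragingWeight μ (n + 1) (c n))
    (n : ℕ) (p : ComplexSpace N × ComplexSpace N) :
    ‖kernelTerm c n p‖ ≤ (‖p.1‖ * ‖p.2‖) ^ n / n.factorial := by
  induction n generalizing p with
  | zero => simp [kernelTerm]
  | succ n ih =>
    have hterm (g : coxeterGroup R) :
        ‖pairing (complexify g.1 p.1, p.2) * kernelTerm c n (complexify g.1 p.1, p.2)‖ ≤
          (‖p.1‖ * ‖p.2‖) * ((‖p.1‖ * ‖p.2‖) ^ n / n.factorial) := by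
      rw [norm_mul, ← norm_complexify g.1 p.1]
      gcongr
      exacts [norm_pairing_le _, ih _]
    calc ‖kernelTerm c (n + 1) p‖ ≤ ∑ g : coxeterGroup R, c n g *
          ((‖p.1‖ * ‖p.2‖) * ((‖p.1‖ * ‖p.2‖) ^ n / n.factorial)) :=
          (norm_sum_le _ _).trans <| Finset.sum_le_sum fun g _ => by
            have hcg : 0 ≤ c n g := (hc n).nonneg hμ_nonneg n.cast_add_one_pos g
            rw [norm_smul, Real.norm_of_nonneg hcg]
            exact mul_le_mul_of_nonneg_left (hterm g) hcg
      _ = (‖p.1‖ * ‖p.2‖) ^ (n + 1) / (n + 1).factorial := by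
          have hsum : ∑ g, c n g = 1 / (n + 1 : ℝ) :=
            eq_one_div_of_mul_eq_one_right (hc n).mul_sum_eq_one
          rw [← Finset.sum_mul, hsum, Nat.factorial_succ, pow_succ', Nat.cast_mul,
            Nat.cast_add_one]
          field_simp

theorem dunklDifferential_kernelTerm_apply_self
    (hc : ∀ n : ℕ, IsAveragingWeight μ (n + 1) (c n)) (n : ℕ)
    (x y : RealSpace N) :
    dunklDifferential μ (fun x => kernelTerm c (n + 1) (toComplex x, toComplex y)) x x =
      ⟪y, x⟫_ℝ • kernelTerm c n (toComplex x, toComplex y) := by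
  have hdiff := (contDiff_kernelTerm_toComplex c (k := 1) (n + 1) y).differentiable one_ne_zero
  rw [dunklDifferential_apply_self, fderiv_apply_self_of_homogeneous (hdiff x) fun s _ =>
    kernelTerm_toComplex_smul c (n + 1) s x y]
  have haverage := (hc n).smul_sum_add fun g : coxeterGroup R =>
    (⟪y, g.1 x⟫_ℝ : ℂ) * kernelTerm c n (toComplex (g.1 x), toComplex y)
  simp only [kernelTerm, complexify_toComplex, pairing_toComplex, Nat.cast_add_one]
  exact haverage

theorem dunklDifferential_kernelTerm_succ (hR : IsRootSystem R) (hμ : IsMultiplicityFunction R μ)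
    (hμ_nonneg : ∀ α, 0 ≤ μ α) (hc : ∀ n : ℕ, IsAveragingWeight μ (n + 1) (c n)) (n : ℕ)
    (x y : RealSpace N) :
    dunklDifferential μ (fun x => kernelTerm c (n + 1) (toComplex x, toComplex y)) x =
      (innerSL ℝ y).smulRight (kernelTerm c n (toComplex x, toComplex y)) := by
  have hradial (n : ℕ) (hgrad : ∀ x, ∃ a : ℂ, dunklDifferential μ
      (fun x => kernelTerm c n (toComplex x, toComplex y)) x = (innerSL ℝ y).smulRight a) :=
    dunklDifferential_eq_smulRight hR hμ hμ_nonneg (contDiff_kernelTerm_toComplex c (n + 1) y)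
      ((contDiff_kernelTerm_toComplex c (k := 1) n y).differentiable one_ne_zero)
      (fun s z => kernelTerm_toComplex_smul c (n + 1) s z y)
      (fun s z => kernelTerm_toComplex_smul c n s z y)
      (fun x => dunklDifferential_kernelTerm_apply_self hc n x y) hgrad
  induction n generalizing x with
  | zero =>
    refine hradial 0 (fun x => ⟨0, ?_⟩) x
    simp only [kernelTerm, dunklDifferential_const, ContinuousLinearMap.smulRight_zero]
  | succ n ih => exact hradial (n + 1) (fun x => ⟨_, ih x⟩) x

end Components

/-! ### The Dunkl kernel -/

section Kernel

variable {N : ℕ} {R : Finset (RealSpace N)} {μ : R → ℝ}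

section Series

variable [Fintype (coxeterGroup R)] {c : ℕ → coxeterGroup R → ℝ}

theorem norm_kernelTerm_le_of_mem_closedBall (hμ_nonneg : ∀ α, 0 ≤ μ α)
    (hc : ∀ n : ℕ, IsAveragingWeight μ (n + 1) (c n)) (n : ℕ)
    {p q : ComplexSpace N × ComplexSpace N} {ε : ℝ} (hq : q ∈ Metric.closedBall p ε) :
    ‖kernelTerm c n q‖ ≤ ((‖p‖ + ε) * (‖p‖ + ε)) ^ n / n.factorial := by
  have hnorm : ‖q‖ ≤ ‖p‖ + ε := by
    linarith [norm_le_norm_add_norm_sub p q, mem_closedBall_iff_norm'.1 hq]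
  have hfst := (norm_fst_le q).trans hnorm
  have hsnd := (norm_snd_le q).trans hnorm
  have hε : 0 ≤ ‖p‖ + ε := (norm_nonneg q).trans hnorm
  refine (norm_kernelTerm_le hμ_nonneg hc n q).trans ?_
  gcongr

theorem summable_kernelTerm (hμ_nonneg : ∀ α, 0 ≤ μ α)
    (hc : ∀ n : ℕ, IsAveragingWeight μ (n + 1) (c n)) (p : ComplexSpace N × ComplexSpace N) :
    Summable fun n => kernelTerm c n p :=
  .of_norm_bounded (Real.summable_pow_div_factorial _) (norm_kernelTerm_le hμ_nonneg hc · p)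

theorem hasFDerivAt_tsum_kernelTerm (hμ_nonneg : ∀ α, 0 ≤ μ α)
    (hc : ∀ n : ℕ, IsAveragingWeight μ (n + 1) (c n)) (p : ComplexSpace N × ComplexSpace N) :
    HasFDerivAt (fun p => ∑' n, kernelTerm c n p) (∑' n, fderiv ℂ (kernelTerm c n) p) p :=
  hasFDerivAt_tsum_of_norm_le (differentiable_kernelTerm c) (Real.summable_pow_div_factorial _)
    fun n _ hq => norm_kernelTerm_le_of_mem_closedBall hμ_nonneg hc n hq

theorem summable_fderiv_kernelTerm (hμ_nonneg : ∀ α, 0 ≤ μ α)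
    (hc : ∀ n : ℕ, IsAveragingWeight μ (n + 1) (c n)) (p : ComplexSpace N × ComplexSpace N) :
    Summable fun n => fderiv ℂ (kernelTerm c n) p :=
  summable_fderiv_of_norm_le (differentiable_kernelTerm c) (Real.summable_pow_div_factorial _)
    fun n _ hq => norm_kernelTerm_le_of_mem_closedBall hμ_nonneg hc n hq

theorem hasSum_fderiv_kernelTerm (hμ_nonneg : ∀ α, 0 ≤ μ α)
    (hc : ∀ n : ℕ, IsAveragingWeight μ (n + 1) (c n)) (x y : RealSpace N) :
    HasSum (fun n => fderiv ℝ (fun x => kernelTerm c n (toComplex x, toComplex y)) x)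
      (fderiv ℝ (fun x => ∑' n, kernelTerm c n (toComplex x, toComplex y)) x) := by
  have hderiv := hasFDerivAt_tsum_kernelTerm hμ_nonneg hc (toComplex x, toComplex y)
  rw [fderiv_left_toComplex hderiv]
  simp only [fderiv_left_toComplex (differentiable_kernelTerm c _ _).hasFDerivAt]
  exact hasSum_restrictScalars_comp _ (summable_fderiv_kernelTerm hμ_nonneg hc _).hasSum

theorem dunklDifferential_tsum_kernelTerm (hR : IsRootSystem R)
    (hμ : IsMultiplicityFunction R μ) (hμ_nonneg : ∀ α, 0 ≤ μ α)
    (hc : ∀ n : ℕ, IsAveragingWeight μ (n + 1) (c n)) (x y : RealSpace N) :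
    dunklDifferential μ (fun x => ∑' n, kernelTerm c n (toComplex x, toComplex y)) x =
      (innerSL ℝ y).smulRight (∑' n, kernelTerm c n (toComplex x, toComplex y)) := by
  have hsum (x : RealSpace N) :=
    (summable_kernelTerm hμ_nonneg hc (toComplex x, toComplex y)).hasSum
  refine (hasSum_dunklDifferential hsum (hasSum_fderiv_kernelTerm hμ_nonneg hc x y)).unique ?_
  rw [← hasSum_nat_add_iff' 1, Finset.sum_range_one]
  simp only [dunklDifferential_kernelTerm_succ hR hμ hμ_nonneg hc]
  simp only [kernelTerm, dunklDifferential_const, sub_zero]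
  exact (hsum x).mapL (ContinuousLinearMap.smulRightL ℝ (RealSpace N) ℂ (innerSL ℝ y))

theorem isDunklKernel_tsum_kernelTerm (hR : IsRootSystem R) (hμ : IsMultiplicityFunction R μ)
    (hμ_nonneg : ∀ α, 0 ≤ μ α) (hc : ∀ n : ℕ, IsAveragingWeight μ (n + 1) (c n)) :
    IsDunklKernel μ fun z w => ∑' n, kernelTerm c n (z, w) where
  holomorphic p := (hasFDerivAt_tsum_kernelTerm hμ_nonneg hc p).differentiableAt
  real_valued x y := by
    rw [Complex.im_tsum (summable_kernelTerm hμ_nonneg hc _)]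
    simp only [im_kernelTerm, tsum_zero]
  eigen ξ x y := by
    rw [dunklOperator_eq, dunklDifferential_tsum_kernelTerm hR hμ hμ_nonneg hc,
      ContinuousLinearMap.smulRight_apply, innerSL_apply_apply, real_inner_comm, Complex.real_smul]
  map_zero y := by
    have hzero (n : ℕ) (hn : n ≠ 0) : kernelTerm c n (0, toComplex y) = 0 := by
      simpa [hn] using kernelTerm_smul_left c n 0 0 (toComplex y)
    exact (tsum_eq_single 0 hzero).trans rfl

end Series

theorem isDunklKernel_dunklKernel (hR : IsRootSystem R) (hμ : IsMultiplicityFunction R μ)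
    (hμ_nonneg : ∀ α, 0 ≤ μ α) : IsDunklKernel μ (dunklKernel μ) := by
  have := hR.finite_coxeterGroup
  have := Fintype.ofFinite (coxeterGroup R)
  choose c hc using fun n : ℕ => exists_isAveragingWeight hμ_nonneg n.cast_add_one_pos
  exact Classical.epsilon_spec ⟨_, isDunklKernel_tsum_kernelTerm hR hμ hμ_nonneg hc⟩

end Kernel

/-! ### The heat kernel and the Version A kernel -/

section HeatKernel

variable {N : ℕ} {R : Finset (RealSpace N)} {μ : R → ℝ} {t : ℝ}

namespace IsDunklKernel

theorem isHolomorphicContinuation_heatKernel (hE : IsDunklKernel μ (dunklKernel μ)) :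
    IsHolomorphicContinuation (heatKernel μ t) fun z w =>
      Complex.exp (-(bilinSq z + bilinSq w) / (2 * (t : ℂ))) *
        dunklKernel μ ((((Real.sqrt t)⁻¹ : ℝ) : ℂ) • z) ((((Real.sqrt t)⁻¹ : ℝ) : ℂ) • w) where
  holomorphic := by
    have hexponent : Differentiable ℂ fun p : ComplexSpace N × ComplexSpace N =>
        -(bilinSq p.1 + bilinSq p.2) / (2 * (t : ℂ)) := by
      have := differentiable_bilinSq (N := N)
      fun_prop
    have hscale : Differentiable ℂ fun p : ComplexSpace N × ComplexSpace N =>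
        ((((Real.sqrt t)⁻¹ : ℝ) : ℂ) • p.1, (((Real.sqrt t)⁻¹ : ℝ) : ℂ) • p.2) := by fun_prop
    exact hexponent.cexp.mul (hE.holomorphic.comp hscale)
  extends_real x y := by
    rw [heatKernel, ← toComplex_smul, ← toComplex_smul, bilinSq_toComplex, bilinSq_toComplex,
      Complex.ofReal_mul, Complex.ofReal_exp]
    congr 1
    · push_cast
      rfl
    · exact Complex.ext rfl (hE.real_valued _ _)

theorem isHolomorphicContinuation_heatKernelC (hE : IsDunklKernel μ (dunklKernel μ)) :
    IsHolomorphicContinuation (heatKernel μ t) (heatKernelC μ t) :=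
  Classical.epsilon_spec ⟨_, hE.isHolomorphicContinuation_heatKernel⟩

theorem heatKernelC_eq (hE : IsDunklKernel μ (dunklKernel μ)) (z w : ComplexSpace N) :
    heatKernelC μ t z w = Complex.exp (-(bilinSq z + bilinSq w) / (2 * (t : ℂ))) *
      dunklKernel μ ((((Real.sqrt t)⁻¹ : ℝ) : ℂ) • z) ((((Real.sqrt t)⁻¹ : ℝ) : ℂ) • w) := by
  have hC := hE.isHolomorphicContinuation_heatKernelC (t := t)
  have hformula := hE.isHolomorphicContinuation_heatKernel (t := t)
  exact congrFun₂ (hC.holomorphic.ext_real hformula.holomorphic fun x y =>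
    (hC.extends_real x y).trans (hformula.extends_real x y).symm) z w

theorem heatKernel_zero_left (hE : IsDunklKernel μ (dunklKernel μ)) (q : RealSpace N) :
    heatKernel μ t 0 q = Real.exp (-‖q‖ ^ 2 / (2 * t)) := by
  simp [heatKernel, toComplex_zero, hE.map_zero]

theorem heatKernel_zero_left_pos (hE : IsDunklKernel μ (dunklKernel μ)) (q : RealSpace N) :
    0 < heatKernel μ t 0 q :=
  hE.heatKernel_zero_left q ▸ Real.exp_pos _

theorem versionAKernel_eq (hE : IsDunklKernel μ (dunklKernel μ)) (z : ComplexSpace N)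
    (q : RealSpace N) : versionAKernel μ t z q = heatKernelC μ t z (toComplex q) /
      ((Real.sqrt (heatKernel μ t 0 q) : ℝ) : ℂ) := by
  rw [hE.heatKernelC_eq, hE.heatKernel_zero_left, ← Real.exp_half, Complex.ofReal_exp,
    mul_div_right_comm, ← Complex.exp_sub, versionAKernel, toComplex_smul, bilinSq_toComplex]
  congr 2
  push_cast
  ring

end IsDunklKernel

end HeatKernel

end Dunkl

end

theorem mainTheorem4 {N : ℕ} (R : Finset (Dunkl.RealSpace N)) (hR : Dunkl.IsRootSystem R)
    (μ : R → ℝ) (hμ : Dunkl.IsMultiplicityFunction R μ) (hμ_nonneg : ∀ α, 0 ≤ μ α)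
    (t : ℝ) (ht : 0 < t) :
    Dunkl.IsDunklKernel μ (Dunkl.dunklKernel μ) ∧
    Dunkl.IsHolomorphicContinuation (Dunkl.heatKernel μ t) (Dunkl.heatKernelC μ t) ∧
    (∀ q : Dunkl.RealSpace N, 0 < Dunkl.heatKernel μ t 0 q) ∧
    ∀ (z : Dunkl.ComplexSpace N) (q : Dunkl.RealSpace N),
      Dunkl.versionAKernel μ t z q =
        Dunkl.heatKernelC μ t z (Dunkl.toComplex q) /
          ((Real.sqrt (Dunkl.heatKernel μ t 0 q) : ℝ) : ℂ) := by
  have hE := Dunkl.isDunklKernel_dunklKernel hR hμ hμ_nonneg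
  exact ⟨hE, hE.isHolomorphicContinuation_heatKernelC, hE.heatKernel_zero_left_pos,
    hE.versionAKernel_eq⟩
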